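/- Let $k$ be a field. A finite linear category is a $k$-linear category that is equivalent, as a $k$-linear category, to the category of finite-dimensional modules over some finite-dimensional $k$-algebra; $\mathcal A,\mathcal B,\mathcal C,\mathcal X$ denote finite linear categories and all functors are $k$-linear. For an object $x$ of $\mathcal X$ and a finite-dimensional vector space $V$, let $V\otimes x\in\mathcal X$ be the object with $\mathrm{Hom}(V\otimes x,z)\cong\mathrm{Hom}_k(V,\mathrm{Hom}(x,z))$ naturally in $z$. The left exact and the right exact Nakayama functor of $\mathcal X$ are the endofunctors of $\mathcal X$ $$N^{\rm l}_{\mathcal X}(y)=\int_{x\in\mathcal X}\mathrm{Hom}_{\mathcal X}(x,y)\otimes x,\qquad N^{\rm r}_{\mathcal X}(y)=\int^{x\in\mathcal X}\mathrm{Hom}_{\mathcal X}(y,x)^*\otimes x ;$$ these ends and coends exist. Write $F^{\rm la}$, $F^{\rm ra}$ for a left, respectively right, adjoint of a functor $F$, and $F^{\rm lla}=(F^{\rm la})^{\rm la}$, $F^{\rm rra}=(F^{\rm ra})^{\rm ra}$. **Theorem 3.10.** (i) For every left exact functor $F\colon\mathcal A\to\mathcal B$ having a left exact left adjoint $F^{\rm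 la}$ which in turn has a left exact left adjoint $F^{\rm lla}$, there is a natural isomorphism $$\varphi^{\rm l}_F\colon\ N^{\rm l}_{\mathcal B}\circ F\;\cong\;F^{\rm lla}\circ N^{\rm l}_{\mathcal A}.$$ Analogously, for every right exact functor $G\colon\mathcal A\to\mathcal B$ having a right exact right adjoint $G^{\rm ra}$ which in turn has a right exact right adjoint $G^{\rm rra}$, there is a natural isomorphism $$\varphi^{\rm r}_G\colon\ N^{\rm r}_{\mathcal B}\circ G\;\cong\;G^{\rm rra}\circ N^{\rm r}_{\mathcal A}.$$ (ii) These isomorphisms can be chosen, for all such $F$ and $G$ and all choices of the adjoints and of the (co)ends involved, so that they are coherent: for all $F_1\colon\mathcal A\to\mathcal B$ and $F_2\colon\mathcal B\to\mathcal C$ as in the first part of (i) and every choice of $(F_2\circ F_1)^{\rm la}$ and $(F_2\circ F_1)^{\rm lla}$, the composite $$N^{\rm l}_{\mathcal C}F_2F_1\xrightarrow{\ \varphi^{\rm l}_{F_2}\circ\,\mathrm{id}\ }F_2^{\rm lla}N^{\rm l}_{\mathcal B}F_1\xrightarrow{\ \mathrm{id}\,\circ\,\varphi^{\rm l}_{F_1}\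 }F_2^{\rm lla}F_1^{\rm lla}N^{\rm l}_{\mathcal A}$$ equals the composite $$N^{\rm l}_{\mathcal C}F_2F_1\xrightarrow{\ \varphi^{\rm l}_{F_2\circ F_1}\ }(F_2\circ F_1)^{\rm lla}N^{\rm l}_{\mathcal A}\xrightarrow{\ \cong\ }F_2^{\rm lla}F_1^{\rm lla}N^{\rm l}_{\mathcal A},$$ the last arrow being induced by the canonical isomorphism $(F_2\circ F_1)^{\rm lla}\cong F_2^{\rm lla}\circ F_1^{\rm lla}$ given by the uniqueness of adjoints. Likewise, for all $G_1\colon\mathcal A\to\mathcal B$ and $G_2\colon\mathcal B\to\mathcal C$ as in the second part of (i), the analogous diagram for $\varphi^{\rm r}$, with the canonical isomorphism $(G_2\circ G_1)^{\rm rra}\cong G_2^{\rm rra}\circ G_1^{\rm rra}$, commutes. -/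

import Mathlib

open CategoryTheory CategoryTheory.Limits Opposite

universe u v w

noncomputable section

namespace FinLin

/-! ### Finite linear categories -/

/-- A `k`-linear category is finite if it is equivalent, as a linear category, to the category of
finite-dimensional modules over a finite-dimensional `k`-algebra `A` (for such an `A`, a module is
finite-dimensional over `k` if and only if it is finitely generated over `A`). -/
class IsFiniteLinear (k : Type u) [Field k] (X : Type w) [Category.{v} X] [Preadditive X]
    [Linear k X] : Prop where
  exists_equiv : ∃ (A : Type u) (_ : Ring A) (_ : Algebra k A) (_ : Module.Finite k A)
    (e : X ≌ FGModuleCat.{u} A), e.functor.Additive ∧ e.functor.Linear k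

/-- Finitely generated modules are closed under finite direct sums. -/
theorem hasFiniteBiproducts_fgModuleCat (A : Type u) [Ring A] :
    HasFiniteBiproducts (FGModuleCat.{u} A) := by
  refine ⟨fun n => ⟨fun f => ?_⟩⟩
  let b : Bicone f :=
    { pt := FGModuleCat.of A (∀ i, f i)
      π := fun j => FGModuleCat.ofHom (LinearMap.proj j)
      ι := fun j => FGModuleCat.ofHom (LinearMap.single A (fun i => (f i : Type u)) j)
      ι_π := fun j j' => by
        apply FGModuleCat.hom_ext
        by_cases h : j = j'
        · subst h
          rw [dif_pos rfl]
          exact LinearMap.proj_comp_single_same A (fun i => (f i : Type u)) j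
        · rw [dif_neg h]
          exact LinearMap.proj_comp_single_ne A (fun i => (f i : Type u)) j' j (Ne.symm h) }
  refine hasBiproduct_of_total b ?_
  let ev : (b.pt ⟶ b.pt) →+ ((∀ i, f i) →ₗ[A] (∀ i, f i)) :=
    { toFun := fun g => g.hom.hom
      map_zero' := rfl
      map_add' := fun _ _ => rfl }
  apply FGModuleCat.hom_ext
  change ev _ = LinearMap.id
  rw [map_sum]
  apply LinearMap.ext
  intro x
  rw [LinearMap.sum_apply]
  exact LinearMap.sum_single_apply (fun i => (f i : Type u)) x

theorem IsFiniteLinear.hasFiniteBiproducts (k : Type u) [Field k] (X : Type w) [Category.{v} X]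
    [Preadditive X] [Linear k X] [h : IsFiniteLinear k X] : HasFiniteBiproducts X := by
  obtain ⟨A, _, _, _, e, _, _⟩ := h.exists_equiv
  have := hasFiniteBiproducts_fgModuleCat A
  have : HasFiniteProducts X :=
    ⟨fun n => Adjunction.hasLimitsOfShape_of_equivalence e.functor⟩
  exact HasFiniteBiproducts.of_hasFiniteProducts

theorem IsFiniteLinear.finite_hom (k : Type u) [Field k] (X : Type w) [Category.{v} X]
    [Preadditive X] [Linear k X] [h : IsFiniteLinear k X] (x y : X) :
    Module.Finite k (x ⟶ y) := by
  obtain ⟨A, _, _, _, e, _, _⟩ := h.exists_equiv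
  let _ := ModuleCat.moduleOfAlgebraModule (k := k) (e.functor.obj x).obj
  let _ := ModuleCat.moduleOfAlgebraModule (k := k) (e.functor.obj y).obj
  have := ModuleCat.isScalarTower_of_algebra_moduleCat (k := k) (e.functor.obj x).obj
  have := ModuleCat.isScalarTower_of_algebra_moduleCat (k := k) (e.functor.obj y).obj
  have h1 : Module.Finite A (e.functor.obj x).obj := (e.functor.obj x).property
  have h2 : Module.Finite A (e.functor.obj y).obj := (e.functor.obj y).property
  have h3 : Module.Finite k (e.functor.obj x).obj := Module.Finite.trans A _
  have h4 : Module.Finite k (e.functor.obj y).obj := Module.Finite.trans A _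
  let L : (x ⟶ y) →ₗ[k] ((e.functor.obj x).obj →ₗ[k] (e.functor.obj y).obj) :=
    { toFun := fun f => (e.functor.map f).hom.hom.restrictScalars k
      map_add' := fun f g => by rw [e.functor.map_add]; rfl
      map_smul' := fun r f => by rw [e.functor.map_smul]; rfl }
  refine Module.Finite.of_injective L fun f g hfg => ?_
  apply e.functor.map_injective
  apply FGModuleCat.hom_ext
  exact LinearMap.restrictScalars_injective k hfg

set_option linter.checkUnivs false in
/-- Bundled finite `k`-linear categories. -/
structure FinLinCat (k : Type u) [Field k] where
  carrier : Type w
  [cat : Category.{v} carrier]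
  [preadditive : Preadditive carrier]
  [linear : Linear k carrier]
  [finite : IsFiniteLinear k carrier]

instance (k : Type u) [Field k] : CoeSort (FinLinCat.{u, v, w} k) (Type w) :=
  ⟨FinLinCat.carrier⟩

attribute [instance] FinLinCat.cat FinLinCat.preadditive FinLinCat.linear FinLinCat.finite

section

variable {k : Type u} [Field k] (X : FinLinCat.{u, v, w} k)

instance : HasFiniteBiproducts X := IsFiniteLinear.hasFiniteBiproducts k X

instance (x y : X) : Module.Finite k (x ⟶ y) := IsFiniteLinear.finite_hom k X x y

end

/-! ### The action of finite-dimensional vector spaces -/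

section Copower

variable {k : Type u} [Field k] {X : FinLinCat.{u, v, w} k}
variable (V : Type*) [AddCommGroup V] [Module k V] [Module.Finite k V]
variable {V' : Type*} [AddCommGroup V'] [Module k V'] [Module.Finite k V']
variable {V'' : Type*} [AddCommGroup V''] [Module k V''] [Module.Finite k V'']

/-- The object `V ⊗ c`, a direct sum of `dim V` copies of `c`. Together with `copower.ι` it is
characterised by its universal property `Hom(V ⊗ c, d) ≅ Hom_k(V, Hom(c, d))`,
see `copower.ι_desc` and `copower.hom_ext`. -/
def copower (c : X) : X := ⨁ fun _ : Fin (Module.finrank k V) => c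

/-- The inclusion of the `i`-th summand. -/
def copower.incl (c : X) (i : Fin (Module.finrank k V)) : c ⟶ copower V c :=
  biproduct.ι (fun _ : Fin (Module.finrank k V) => c) i

/-- The universal linear map `V → Hom(c, V ⊗ c)`, i.e. `v ↦ (v ⊗ -)`. -/
def copower.ι (c : X) : V →ₗ[k] (c ⟶ copower V c) where
  toFun v := ∑ i, (Module.finBasis k V).repr v i • copower.incl V c i
  map_add' v v' := by simp [add_smul, Finset.sum_add_distrib]
  map_smul' r v := by simp [mul_smul, Finset.smul_sum]

variable {V}

/-- The morphism out of `V ⊗ c` defined by a linear map `V → Hom(c, d)`. -/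
def copower.desc {c d : X} (φ : V →ₗ[k] (c ⟶ d)) : copower V c ⟶ d :=
  biproduct.desc fun i => φ (Module.finBasis k V i)

theorem copower.incl_desc {c d : X} (φ : V →ₗ[k] (c ⟶ d)) (i : Fin (Module.finrank k V)) :
    copower.incl V c i ≫ copower.desc φ = φ (Module.finBasis k V i) :=
  biproduct.ι_desc _ _

@[simp]
theorem copower.ι_desc {c d : X} (φ : V →ₗ[k] (c ⟶ d)) (v : V) :
    copower.ι V c v ≫ copower.desc φ = φ v := by
  simp only [copower.ι, LinearMap.coe_mk, AddHom.coe_mk]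
  rw [Preadditive.sum_comp]
  conv_rhs => rw [← (Module.finBasis k V).sum_repr v, map_sum]
  simp [copower.incl_desc]

theorem copower.hom_ext {c d : X} {f g : copower V c ⟶ d}
    (h : ∀ v, copower.ι V c v ≫ f = copower.ι V c v ≫ g) : f = g := by
  apply biproduct.hom_ext'
  intro i
  have hi : copower.ι V c (Module.finBasis k V i) = copower.incl V c i := by
    simp [copower.ι, Finsupp.single_apply]
  have := h (Module.finBasis k V i)
  rw [hi] at this
  exact this

/-- Functoriality of `V ⊗ c` in both arguments. -/
def copower.map {c d : X} (f : V →ₗ[k] V') (g : c ⟶ d) : copower V c ⟶ copower V' d :=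
  copower.desc (Linear.leftComp k _ g ∘ₗ copower.ι V' d ∘ₗ f)

@[simp]
theorem copower.ι_map {c d : X} (f : V →ₗ[k] V') (g : c ⟶ d) (v : V) :
    copower.ι V c v ≫ copower.map f g = g ≫ copower.ι V' d (f v) := by
  simp [copower.map]

theorem copower.map_id (c : X) : copower.map (LinearMap.id : V →ₗ[k] V) (𝟙 c) = 𝟙 _ :=
  copower.hom_ext fun v => by simp

theorem copower.map_comp_map {c d e : X} (f : V →ₗ[k] V') (f' : V' →ₗ[k] V'')
    (g : c ⟶ d) (g' : d ⟶ e) :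
    copower.map f g ≫ copower.map f' g' = copower.map (f' ∘ₗ f) (g ≫ g') :=
  copower.hom_ext fun v => by
    rw [← Category.assoc, copower.ι_map, Category.assoc, copower.ι_map, copower.ι_map]
    simp

end Copower

/-! ### The Nakayama functors -/

section Nakayama

variable {k : Type u} [Field k] {X : FinLinCat.{u, v, w} k}

/-- The bifunctor `(x', x) ↦ Hom(x', y) ⊗ x`. -/
def homCopower (y : X) : (X : Type w)ᵒᵖ ⥤ X ⥤ X where
  obj x' :=
    { obj := fun x => copower (x'.unop ⟶ y) x
      map := fun f => copower.map (LinearMap.id : (x'.unop ⟶ y) →ₗ[k] _) f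
      map_id := fun _ => copower.map_id _
      map_comp := fun _ _ => by rw [copower.map_comp_map]; rfl }
  map g :=
    { app := fun x => copower.map (Linear.leftComp k y g.unop) (𝟙 x)
      naturality := fun _ _ _ => by
        rw [copower.map_comp_map, copower.map_comp_map, Category.id_comp, Category.comp_id]
        rfl }
  map_id x' := by
    apply NatTrans.ext
    funext x
    refine Eq.trans ?_ (copower.map_id x)
    exact congrArg (fun l => copower.map l (𝟙 x)) (by ext; simp)
  map_comp g g' := by
    apply NatTrans.ext
    funext x
    refine Eq.trans ?_ (copower.map_comp_map _ _ _ _).symm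
    rw [Category.comp_id]
    exact congrArg (fun l => copower.map l (𝟙 x)) (by ext; simp)

/-- The bifunctor `(x', x) ↦ Hom(y, x')^* ⊗ x`, where `^*` denotes the dual vector space. -/
def dualHomCopower (y : X) : (X : Type w)ᵒᵖ ⥤ X ⥤ X where
  obj x' :=
    { obj := fun x => copower (Module.Dual k (y ⟶ x'.unop)) x
      map := fun f => copower.map (LinearMap.id : Module.Dual k (y ⟶ x'.unop) →ₗ[k] _) f
      map_id := fun _ => copower.map_id _
      map_comp := fun _ _ => by rw [copower.map_comp_map]; rfl }
  map g :=
    { app := fun x => copower.map (Linear.rightComp k y g.unop).dualMap (𝟙 x)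
      naturality := fun _ _ _ => by
        rw [copower.map_comp_map, copower.map_comp_map, Category.id_comp, Category.comp_id]
        rfl }
  map_id x' := by
    apply NatTrans.ext
    funext x
    refine Eq.trans ?_ (copower.map_id x)
    exact congrArg (fun l => copower.map l (𝟙 x)) (by ext; simp)
  map_comp g g' := by
    apply NatTrans.ext
    funext x
    refine Eq.trans ?_ (copower.map_comp_map _ _ _ _).symm
    rw [Category.comp_id]
    exact congrArg (fun l => copower.map l (𝟙 x)) (by ext; simp)

variable (X)

/-- A choice of the ends `∫_{x ∈ X} Hom(x, y) ⊗ x` for all `y`. -/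
structure LeftNakayama where
  wedge (y : X) : Wedge (homCopower y)
  isLimit (y : X) : IsLimit (wedge y)

/-- A choice of the coends `∫^{x ∈ X} Hom(y, x)^* ⊗ x` for all `y`. -/
structure RightNakayama where
  cowedge (y : X) : Cowedge (dualHomCopower y)
  isColimit (y : X) : IsColimit (cowedge y)

variable {X}

namespace LeftNakayama

variable (N : LeftNakayama X)

/-- The universal dinatural family of the end `∫_{x ∈ X} Hom(x, y) ⊗ x`. -/
def π (y x : X) : (N.wedge y).pt ⟶ copower (x ⟶ y) x := (N.wedge y).ι x

theorem π_dinatural (y : X) {x x' : X} (f : x ⟶ x') :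
    N.π y x ≫ copower.map (LinearMap.id : (x ⟶ y) →ₗ[k] _) f =
      N.π y x' ≫ copower.map (Linear.leftComp k y f) (𝟙 x') :=
  Wedge.condition (N.wedge y) f

theorem hom_ext {y z : X} {f g : z ⟶ (N.wedge y).pt} (h : ∀ x, f ≫ N.π y x = g ≫ N.π y x) :
    f = g :=
  Wedge.IsLimit.hom_ext (N.isLimit y) h

/-- The morphism of ends induced by the maps `Hom(x, g) ⊗ x`. -/
def map {y y' : X} (g : y ⟶ y') : (N.wedge y).pt ⟶ (N.wedge y').pt :=
  Wedge.IsLimit.lift (N.isLimit y')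
    (fun x => N.π y x ≫ copower.map (Linear.rightComp k x g) (𝟙 x))
    (fun x x' f => by
      refine (Category.assoc _ _ _).trans (Eq.trans ?_ (Category.assoc _ _ _).symm)
      have h : copower.map (Linear.rightComp k x g) (𝟙 x) ≫
          copower.map (LinearMap.id : (x ⟶ y') →ₗ[k] _) f =
          copower.map (LinearMap.id : (x ⟶ y) →ₗ[k] _) f ≫
            copower.map (Linear.rightComp k x g) (𝟙 x') := by
        rw [copower.map_comp_map, copower.map_comp_map, Category.id_comp, Category.comp_id]
        rfl
      have h' : copower.map (Linear.leftComp k y f) (𝟙 x') ≫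
          copower.map (Linear.rightComp k x g) (𝟙 x') =
          copower.map (Linear.rightComp k x' g) (𝟙 x') ≫
            copower.map (Linear.leftComp k y' f) (𝟙 x') := by
        rw [copower.map_comp_map, copower.map_comp_map]
        exact congrArg (fun l => copower.map l (𝟙 x' ≫ 𝟙 x')) (by ext; simp)
      refine (congrArg (N.π y x ≫ ·) h).trans ?_
      refine Eq.trans ?_ (congrArg (N.π y x' ≫ ·) h')
      rw [← Category.assoc, ← Category.assoc, N.π_dinatural y f])

theorem map_π {y y' : X} (g : y ⟶ y') (x : X) :
    N.map g ≫ N.π y' x = N.π y x ≫ copower.map (Linear.rightComp k x g) (𝟙 x) :=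
  Wedge.IsLimit.lift_ι (N.isLimit y') _ _ x

/-- The left exact Nakayama functor `y ↦ ∫_{x ∈ X} Hom(x, y) ⊗ x`. -/
def functor : X ⥤ X where
  obj y := (N.wedge y).pt
  map g := N.map g
  map_id y := N.hom_ext fun x => by
    have : copower.map (Linear.rightComp k x (𝟙 y)) (𝟙 x) = 𝟙 _ := by
      refine Eq.trans ?_ (copower.map_id x)
      exact congrArg (fun l => copower.map l (𝟙 x)) (by ext; simp)
    rw [map_π, this, Category.id_comp, Category.comp_id]
  map_comp {y y' y''} g g' := N.hom_ext fun x => by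
    have : copower.map (Linear.rightComp k x (g ≫ g')) (𝟙 x) =
        copower.map (Linear.rightComp k x g) (𝟙 x) ≫
          copower.map (Linear.rightComp k x g') (𝟙 x) := by
      rw [copower.map_comp_map, Category.comp_id]
      exact congrArg (fun l => copower.map l (𝟙 x)) (by ext; simp)
    rw [Category.assoc, map_π, map_π, ← Category.assoc, map_π, Category.assoc, this]

end LeftNakayama

namespace RightNakayama

variable (N : RightNakayama X)

/-- The universal dinatural family of the coend `∫^{x ∈ X} Hom(y, x)^* ⊗ x`. -/
def ι (y x : X) : copower (Module.Dual k (y ⟶ x)) x ⟶ (N.cowedge y).pt := (N.cowedge y).π x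

theorem ι_dinatural (y : X) {x x' : X} (f : x ⟶ x') :
    copower.map (Linear.rightComp k y f).dualMap (𝟙 x) ≫ N.ι y x =
      copower.map (LinearMap.id : Module.Dual k (y ⟶ x') →ₗ[k] _) f ≫ N.ι y x' :=
  Cowedge.condition (N.cowedge y) f

theorem hom_ext {y z : X} {f g : (N.cowedge y).pt ⟶ z} (h : ∀ x, N.ι y x ≫ f = N.ι y x ≫ g) :
    f = g :=
  Cowedge.IsColimit.hom_ext (N.isColimit y) h

/-- The morphism of coends induced by the maps `Hom(g, x)^* ⊗ x`. -/
def map {y y' : X} (g : y ⟶ y') : (N.cowedge y).pt ⟶ (N.cowedge y').pt :=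
  Cowedge.IsColimit.desc (N.isColimit y)
    (fun x => copower.map (Linear.leftComp k x g).dualMap (𝟙 x) ≫ N.ι y' x)
    (fun x x' f => by
      refine (Category.assoc _ _ _).symm.trans (Eq.trans ?_ (Category.assoc _ _ _))
      have h : copower.map (Linear.rightComp k y f).dualMap (𝟙 x) ≫
          copower.map (Linear.leftComp k x g).dualMap (𝟙 x) =
          copower.map (Linear.leftComp k x' g).dualMap (𝟙 x) ≫
            copower.map (Linear.rightComp k y' f).dualMap (𝟙 x) := by
        rw [copower.map_comp_map, copower.map_comp_map]
        exact congrArg (fun l => copower.map l (𝟙 x ≫ 𝟙 x)) (by ext; simp)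
      have h' : copower.map (LinearMap.id : Module.Dual k (y ⟶ x') →ₗ[k] _) f ≫
          copower.map (Linear.leftComp k x' g).dualMap (𝟙 x') =
          copower.map (Linear.leftComp k x' g).dualMap (𝟙 x) ≫
            copower.map (LinearMap.id : Module.Dual k (y' ⟶ x') →ₗ[k] _) f := by
        rw [copower.map_comp_map, copower.map_comp_map, Category.id_comp, Category.comp_id]
        rfl
      refine (congrArg (· ≫ N.ι y' x) h).trans ?_
      refine Eq.trans ?_ (congrArg (· ≫ N.ι y' x') h').symm
      rw [Category.assoc, Category.assoc, N.ι_dinatural y' f])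

theorem ι_map {y y' : X} (g : y ⟶ y') (x : X) :
    N.ι y x ≫ N.map g = copower.map (Linear.leftComp k x g).dualMap (𝟙 x) ≫ N.ι y' x :=
  Cowedge.IsColimit.π_desc (N.isColimit y) _ _ x

/-- The right exact Nakayama functor `y ↦ ∫^{x ∈ X} Hom(y, x)^* ⊗ x`. -/
def functor : X ⥤ X where
  obj y := (N.cowedge y).pt
  map g := N.map g
  map_id y := N.hom_ext fun x => by
    have : copower.map (Linear.leftComp k x (𝟙 y)).dualMap (𝟙 x) = 𝟙 _ := by
      refine Eq.trans ?_ (copower.map_id x)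
      exact congrArg (fun l => copower.map l (𝟙 x)) (by ext; simp)
    rw [ι_map, this, Category.id_comp, Category.comp_id]
  map_comp {y y' y''} g g' := N.hom_ext fun x => by
    have : copower.map (Linear.leftComp k x (g ≫ g')).dualMap (𝟙 x) =
        copower.map (Linear.leftComp k x g).dualMap (𝟙 x) ≫
          copower.map (Linear.leftComp k x g').dualMap (𝟙 x) := by
      rw [copower.map_comp_map, Category.comp_id]
      exact congrArg (fun l => copower.map l (𝟙 x)) (by ext; simp)
    rw [ι_map, ← Category.assoc, ι_map, Category.assoc, ι_map, ← Category.assoc, this]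

end RightNakayama

end Nakayama

/-! ### Double adjoints -/

section Adjoints

variable {k : Type u} [Field k] {A B C : FinLinCat.{u, v, w} k}

/-- A left exact left adjoint `F^la` of `F` together with a left exact left adjoint `F^lla` of
`F^la`. -/
structure DoubleLeftAdjoint (F : A ⥤ B) where
  la : B ⥤ A
  lla : A ⥤ B
  adj : la ⊣ F
  adj' : lla ⊣ la
  la_leftExact : PreservesFiniteLimits la
  lla_leftExact : PreservesFiniteLimits lla

/-- A right exact right adjoint `G^ra` of `G` together with a right exact right adjoint `G^rra` of
`G^ra`. -/
structure DoubleRightAdjoint (G : A ⥤ B) where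
  ra : B ⥤ A
  rra : A ⥤ B
  adj : G ⊣ ra
  adj' : ra ⊣ rra
  ra_rightExact : PreservesFiniteColimits ra
  rra_rightExact : PreservesFiniteColimits rra

/-- The canonical isomorphism `(F₂ ∘ F₁)^lla ≅ F₂^lla ∘ F₁^lla`: by uniqueness of adjoints,
`(F₂ ∘ F₁)^la ≅ F₁^la ∘ F₂^la`, and both `(F₂ ∘ F₁)^lla` and `F₂^lla ∘ F₁^lla` are left adjoint
to the latter. -/
def DoubleLeftAdjoint.compIso {F₁ : A ⥤ B} {F₂ : B ⥤ C} (D₁₂ : DoubleLeftAdjoint (F₁ ⋙ F₂))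
    (D₁ : DoubleLeftAdjoint F₁) (D₂ : DoubleLeftAdjoint F₂) : D₁₂.lla ≅ D₁.lla ⋙ D₂.lla :=
  (D₁₂.adj'.ofNatIsoRight (D₁₂.adj.leftAdjointUniq (D₂.adj.comp D₁.adj))).leftAdjointUniq
    (D₁.adj'.comp D₂.adj')

/-- The canonical isomorphism `(G₂ ∘ G₁)^rra ≅ G₂^rra ∘ G₁^rra`. -/
def DoubleRightAdjoint.compIso {G₁ : A ⥤ B} {G₂ : B ⥤ C} (D₁₂ : DoubleRightAdjoint (G₁ ⋙ G₂))
    (D₁ : DoubleRightAdjoint G₁) (D₂ : DoubleRightAdjoint G₂) : D₁₂.rra ≅ D₁.rra ⋙ D₂.rra :=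
  (D₁₂.adj'.ofNatIsoLeft (D₁₂.adj.rightAdjointUniq (D₁.adj.comp D₂.adj))).rightAdjointUniq
    (D₂.adj'.comp D₁.adj')

end Adjoints

end FinLin

end

/-!
A wedge `z ⟶ Hom(x, y) ⊗ L x` is the same as a natural family of linear maps
`Hom(x, y)^* → Hom(z, L x)`, and a cowedge `Hom(y, x)^* ⊗ L x ⟶ z` is the same as a natural family
`Hom(y, x)^* → Hom(L x, z)`. In this language (`LeftFamily`, `RightFamily`) all (co)ends below are
universal natural families.

*Existence and exactness.* A finite linear category has an object `p` (the regular module) such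
that every object is the cokernel of a matrix of endomorphisms of `p`, with all morphisms from `p`
lifting to the generators (`exists_isPresentingObject`). Hence natural families are determined by
their component at `p`, which can be any linear map compatible with `End(p)`
(`LeftFamily.exists_extension`, and `RightFamily.exists_extension` for right exact `L`). So the end
`∫_x Hom(x, y) ⊗ x` is a joint kernel of finitely many endomorphisms of `Hom(p, y) ⊗ p`; in
particular it exists and is preserved by left exact linear functors (`LeftFamily.IsUniversal.map`).
Dually the coend `∫^x Hom(y, x)^* ⊗ x` is a joint cokernel, preserved by right exact linear
functors (`RightFamily.IsUniversal.map`).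

*The isomorphism.* For `F^lla ⊣ F^la ⊣ F` one has
`N(F y) = ∫_b Hom(b, F y) ⊗ b ≅ ∫_b Hom(F^la b, y) ⊗ b ≅ ∫_a Hom(a, y) ⊗ F^lla a ≅ F^lla (N y)`:
the first step is the adjunction `F^la ⊣ F`, the second one is the formal change of variables along
`F^lla ⊣ F^la`, and the last one holds because `F^lla` is left exact. The inverse isomorphism is
characterised by an explicit formula in terms of the counit of `F^lla ⊣ F^la`
(`DoubleLeftAdjoint.invApp_family`). Testing against the universal family reduces the coherence to
the compatibility of the canonical isomorphisms of adjoints with units and counits. The argument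
for the right exact Nakayama functors is dual in form, with
`N(G y) ≅ ∫^b Hom(y, G^ra b)^* ⊗ b ≅ ∫^a Hom(y, a)^* ⊗ G^rra a ≅ G^rra (N y)`.
-/

noncomputable section

namespace FinLin

/-! ### Matrix cokernels and joint kernels -/

section MatrixCokernel

variable {X : Type*} [Category* X] [Preadditive X] {ι κ : Type} [Fintype ι] [Fintype κ]

/-- The family `f i : p ⟶ x` exhibits `x` as the cokernel of the morphism `q^κ ⟶ p^ι` with matrix
`g`; the universal property is stated in terms of the matrix entries, so that no direct sums have
to be chosen. -/
structure IsMatrixCokernel {q p x : X} (g : κ → ι → (q ⟶ p)) (f : ι → (p ⟶ x)) : Prop where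
  rel : ∀ j, ∑ i, g j i ≫ f i = 0
  hom_ext : ∀ {z : X} {h h' : x ⟶ z}, (∀ i, f i ≫ h = f i ≫ h') → h = h'
  exists_desc : ∀ {z : X} (h : ι → (p ⟶ z)), (∀ j, ∑ i, g j i ≫ h i = 0) →
    ∃ d : x ⟶ z, ∀ i, f i ≫ d = h i

theorem IsMatrixCokernel.map {Y : Type*} [Category* Y] [Preadditive Y] [HasFiniteBiproducts X]
    {q p x : X} {g : κ → ι → (q ⟶ p)} {f : ι → (p ⟶ x)} (h : IsMatrixCokernel g f)
    (L : X ⥤ Y) [L.Additive] [PreservesFiniteColimits L] :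
    IsMatrixCokernel (fun j i => L.map (g j i)) (fun i => L.map (f i)) := by
  classical
  let G : (⨁ fun _ : κ => q) ⟶ ⨁ fun _ : ι => p := biproduct.desc fun j => biproduct.lift (g j)
  let π : (⨁ fun _ : ι => p) ⟶ x := biproduct.desc f
  have w : G ≫ π = 0 := by
    refine biproduct.hom_ext' _ _ fun j => ?_
    rw [comp_zero, ← h.rel j]
    simp [G, π, biproduct.lift_desc]
  have hG : ∀ {z : X} (s : (⨁ fun _ : ι => p) ⟶ z), G ≫ s = 0 →
      ∀ j, ∑ i, g j i ≫ biproduct.ι (fun _ : ι => p) i ≫ s = 0 := fun s hs j => by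
    have : biproduct.ι (fun _ : κ => q) j ≫ G ≫ s = 0 := by rw [hs, comp_zero]
    rw [biproduct.ι_desc_assoc, biproduct.lift_eq, Preadditive.sum_comp] at this
    simpa using this
  have hc : IsColimit (CokernelCofork.ofπ π w) := by
    refine CokernelCofork.IsColimit.ofπ π w
      (fun s hs => (h.exists_desc _ (hG s hs)).choose) (fun s hs => ?_) (fun s hs m hm => ?_)
    · refine biproduct.hom_ext' _ _ fun i => ?_
      rw [biproduct.ι_desc_assoc]
      exact (h.exists_desc _ (hG s hs)).choose_spec i
    · refine h.hom_ext fun i => ?_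
      rw [(h.exists_desc _ (hG s hs)).choose_spec i, ← hm, biproduct.ι_desc_assoc]
  have hL := CokernelCofork.mapIsColimit _ hc L
  have hsum : (𝟙 (L.obj (⨁ fun _ : ι => p))) =
      ∑ i, L.map (biproduct.π (fun _ : ι => p) i) ≫ L.map (biproduct.ι (fun _ : ι => p) i) := by
    rw [← L.map_id, ← biproduct.total, L.map_sum]
    simp
  have hsum' : (𝟙 (L.obj (⨁ fun _ : κ => q))) =
      ∑ i, L.map (biproduct.π (fun _ : κ => q) i) ≫ L.map (biproduct.ι (fun _ : κ => q) i) := by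
    rw [← L.map_id, ← biproduct.total, L.map_sum]
    simp
  refine ⟨fun j => ?_, fun {z a b} hab => ?_, fun {z} t ht => ?_⟩
  · simpa using congrArg L.map (h.rel j)
  · refine Cofork.IsColimit.hom_ext hL ?_
    change L.map π ≫ a = L.map π ≫ b
    rw [← Category.id_comp (L.map π), hsum, Preadditive.sum_comp, Preadditive.sum_comp,
      Preadditive.sum_comp]
    refine Finset.sum_congr rfl fun i _ => ?_
    have : L.map (biproduct.ι (fun _ : ι => p) i) ≫ L.map π = L.map (f i) := by
      rw [← L.map_comp, biproduct.ι_desc]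
    simp only [Category.assoc]
    rw [reassoc_of% this, reassoc_of% this, hab]
  · let T : L.obj (⨁ fun _ : ι => p) ⟶ z := ∑ i, L.map (biproduct.π (fun _ : ι => p) i) ≫ t i
    have hT : L.map G ≫ T = 0 := by
      rw [← Category.id_comp (L.map G), hsum', Preadditive.sum_comp, Preadditive.sum_comp]
      refine Finset.sum_eq_zero fun j _ => ?_
      have hj : L.map (biproduct.ι (fun _ : κ => q) j) ≫ L.map G = L.map (biproduct.lift (g j)) := by
        rw [← L.map_comp, biproduct.ι_desc]
      have : L.map (biproduct.lift (g j)) ≫ T = 0 := by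
        rw [← ht j, Preadditive.comp_sum]
        refine Finset.sum_congr rfl fun i _ => ?_
        rw [← L.map_comp_assoc, biproduct.lift_π]
      rw [Category.assoc, Category.assoc, reassoc_of% hj, this, comp_zero]
    obtain ⟨d, hd⟩ : ∃ d : L.obj x ⟶ z, L.map π ≫ d = T :=
      ⟨_, (CokernelCofork.IsColimit.desc' hL T hT).2⟩
    refine ⟨d, fun i => ?_⟩
    have hi : L.map (f i) = L.map (biproduct.ι (fun _ : ι => p) i) ≫ L.map π := by
      rw [← L.map_comp, biproduct.ι_desc]
    rw [hi, Category.assoc, hd, Preadditive.comp_sum, Finset.sum_eq_single i]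
    · rw [← L.map_comp_assoc, biproduct.ι_π_self, L.map_id, Category.id_comp]
    · intro b _ hb
      rw [← L.map_comp_assoc, biproduct.ι_π_ne _ (Ne.symm hb), L.map_zero, zero_comp]
    · simp

/-- A finite family of parallel morphisms has a joint cokernel. -/
theorem exists_isMatrixCokernel [HasFiniteBiproducts X] [HasCokernels X] {q p : X}
    (g : κ → (q ⟶ p)) :
    ∃ (x : X) (f : p ⟶ x), IsMatrixCokernel (fun j (_ : Unit) => g j) (fun _ => f) := by
  classical
  refine ⟨cokernel (biproduct.desc g), cokernel.π (biproduct.desc g), ⟨fun j => ?_,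
    fun h => (cancel_epi (cokernel.π _)).1 (h ()), fun h hh => ?_⟩⟩
  · have := biproduct.ι (fun _ : κ => q) j ≫= cokernel.condition (biproduct.desc g)
    rw [biproduct.ι_desc_assoc, comp_zero] at this
    simpa using this
  · refine ⟨cokernel.desc _ (h ()) ?_, fun _ => cokernel.π_desc _ _ _⟩
    refine biproduct.hom_ext' _ _ fun j => ?_
    simpa using hh j

/-- The morphism `e : x ⟶ q` exhibits `x` as the joint kernel of the morphisms `g j : q ⟶ p`. -/
structure IsJointKernel {x q p : X} (e : x ⟶ q) (g : κ → (q ⟶ p)) : Prop where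
  rel : ∀ j, e ≫ g j = 0
  hom_ext : ∀ {z : X} {h h' : z ⟶ x}, h ≫ e = h' ≫ e → h = h'
  exists_lift : ∀ {z : X} (h : z ⟶ q), (∀ j, h ≫ g j = 0) → ∃ d : z ⟶ x, d ≫ e = h

theorem IsJointKernel.map {Y : Type*} [Category* Y] [Preadditive Y] [HasFiniteBiproducts X]
    {x q p : X} {e : x ⟶ q} {g : κ → (q ⟶ p)} (h : IsJointKernel e g)
    (L : X ⥤ Y) [L.Additive] [PreservesFiniteLimits L] :
    IsJointKernel (L.map e) (fun j => L.map (g j)) := by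
  classical
  have w : e ≫ biproduct.lift g = 0 := biproduct.hom_ext _ _ fun j => by simp [h.rel j]
  have hg : ∀ {z : X} (s : z ⟶ q), s ≫ biproduct.lift g = 0 → ∀ j, s ≫ g j = 0 :=
    fun s hs j => by simpa using hs =≫ biproduct.π (fun _ : κ => p) j
  have hc : IsLimit (KernelFork.ofι e w) :=
    KernelFork.IsLimit.ofι e w
      (fun s hs => (h.exists_lift s (hg s hs)).choose)
      (fun s hs => (h.exists_lift s (hg s hs)).choose_spec)
      (fun s hs m hm => h.hom_ext (by rw [hm, (h.exists_lift s (hg s hs)).choose_spec]))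
  have hL := KernelFork.mapIsLimit _ hc L
  have hsum : (𝟙 (L.obj (⨁ fun _ : κ => p))) =
      ∑ i, L.map (biproduct.π (fun _ : κ => p) i) ≫ L.map (biproduct.ι (fun _ : κ => p) i) := by
    rw [← L.map_id, ← biproduct.total, L.map_sum]
    simp
  refine ⟨fun j => ?_, fun hab => Fork.IsLimit.hom_ext hL hab, fun t ht => ?_⟩
  · simpa using congrArg L.map (h.rel j)
  · have hT : t ≫ L.map (biproduct.lift g) = 0 := by
      rw [← Category.comp_id (L.map (biproduct.lift g)), hsum, Preadditive.comp_sum,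
        Preadditive.comp_sum]
      refine Finset.sum_eq_zero fun j _ => ?_
      rw [← L.map_comp_assoc, biproduct.lift_π, ← Category.assoc, ht j, zero_comp]
    obtain ⟨d, hd⟩ := KernelFork.IsLimit.lift' hL t hT
    exact ⟨d, hd⟩

theorem exists_isJointKernel [HasFiniteBiproducts X] [HasKernels X] {q p : X}
    (g : κ → (q ⟶ p)) : ∃ (x : X) (e : x ⟶ q), IsJointKernel e g := by
  classical
  refine ⟨kernel (biproduct.lift g), kernel.ι (biproduct.lift g), ⟨fun j => ?_,
    fun h => (cancel_mono (kernel.ι _)).1 h, fun h hh => ?_⟩⟩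
  · have := kernel.condition (biproduct.lift g) =≫ biproduct.π (fun _ : κ => p) j
    rwa [Category.assoc, biproduct.lift_π, zero_comp] at this
  · exact ⟨kernel.lift _ h (biproduct.hom_ext _ _ fun j => by simpa using hh j),
      kernel.lift_ι _ _ _⟩

end MatrixCokernel

/-! ### Presenting objects -/

section Generator

/-- Every object is the cokernel of a matrix of endomorphisms of `p`, in such a way that all
morphisms from `p` lift to the generators, as for the regular module over a Noetherian ring. -/
def IsPresentingObject {X : Type*} [Category* X] [Preadditive X] (p : X) : Prop :=
  ∀ x : X, ∃ (n m : ℕ) (g : Fin m → Fin n → (p ⟶ p)) (f : Fin n → (p ⟶ x)),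
    IsMatrixCokernel g f ∧ ∀ s : p ⟶ x, ∃ r : Fin n → (p ⟶ p), s = ∑ i, r i ≫ f i

theorem isPresentingObject_of (A : Type u) [Ring A] [IsNoetherianRing A] :
    IsPresentingObject (FGModuleCat.of A A) := by
  classical
  intro M
  have : Module.Finite A M.obj := M.property
  obtain ⟨n, c, hc⟩ := Module.Finite.exists_fin' A M.obj
  obtain ⟨m, d, hd⟩ := Module.Finite.exists_fin' A (LinearMap.ker c)
  let f : Fin n → (FGModuleCat.of A A ⟶ M) := fun i =>
    FGModuleCat.ofHom (LinearMap.toSpanSingleton A M.obj (c (Pi.single i 1)))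
  let g : Fin m → Fin n → (FGModuleCat.of A A ⟶ FGModuleCat.of A A) := fun j i =>
    FGModuleCat.ofHom (LinearMap.toSpanSingleton A A ((d (Pi.single j 1) : Fin n → A) i))
  -- morphisms out of the regular module are determined by the image of `1`
  let ev (N : FGModuleCat.{u} A) : (FGModuleCat.of A A ⟶ N) →+ N.obj :=
    { toFun := fun s => s.hom.hom (1 : A)
      map_zero' := rfl
      map_add' := fun _ _ => rfl }
  have ev_inj (N : FGModuleCat.{u} A) {s t : FGModuleCat.of A A ⟶ N} (h : ev N s = ev N t) :
      s = t := by
    apply FGModuleCat.hom_ext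
    exact LinearMap.ext_ring h
  have hc_sum (a : Fin n → A) : c a = ∑ i, a i • c (Pi.single i 1) := by
    conv_lhs => rw [pi_eq_sum_univ' a, map_sum]
    refine Finset.sum_congr rfl fun i _ => ?_
    rw [← map_smul]
  refine ⟨n, m, g, f, ⟨fun j => ?_, fun {z h h'} hh => ?_, fun {z} h hh => ?_⟩, fun s => ?_⟩
  · apply ev_inj
    rw [map_sum, map_zero]
    have h0 : c (d (Pi.single j 1)) = 0 := (d (Pi.single j 1)).2
    rw [hc_sum] at h0
    rw [← h0]
    refine Finset.sum_congr rfl fun i _ => ?_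
    change ((1 : A) • (d (Pi.single j 1) : Fin n → A) i) • c (Pi.single i 1) = _
    rw [one_smul]
  · apply FGModuleCat.hom_ext
    refine LinearMap.ext fun x => ?_
    obtain ⟨a, rfl⟩ := hc x
    rw [hc_sum, map_sum, map_sum]
    refine Finset.sum_congr rfl fun i _ => ?_
    rw [map_smul, map_smul]
    have := congrArg (ev z) (hh i)
    change h.hom.hom ((1 : A) • c (Pi.single i 1)) = h'.hom.hom ((1 : A) • c (Pi.single i 1)) at this
    rw [one_smul] at this
    rw [this]
  · let H : (Fin n → A) →ₗ[A] z.obj := ∑ i, (h i).hom.hom ∘ₗ LinearMap.proj i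
    have hH (a : Fin n → A) : H a = ∑ i, (h i).hom.hom (a i) := by
      simp only [H, LinearMap.sum_apply]
      rfl
    have hker : LinearMap.ker c ≤ LinearMap.ker H := by
      have hHd : H ∘ₗ (LinearMap.ker c).subtype ∘ₗ d = 0 := by
        refine LinearMap.pi_ext' fun j => LinearMap.ext_ring ?_
        have := congrArg (ev z) (hh j)
        rw [map_sum, map_zero] at this
        refine (hH _).trans (Eq.trans ?_ this)
        refine Finset.sum_congr rfl fun i _ => ?_
        change _ = (h i).hom.hom ((1 : A) • (d (Pi.single j 1) : Fin n → A) i)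
        rw [one_smul]
        rfl
      intro a ha
      obtain ⟨b, hb⟩ := hd ⟨a, ha⟩
      have := LinearMap.congr_fun hHd b
      change H (d b) = 0 at this
      rw [hb] at this
      exact this
    let q : M.obj →ₗ[A] z.obj :=
      (LinearMap.ker c).liftQ H hker ∘ₗ (c.quotKerEquivOfSurjective hc).symm.toLinearMap
    have hq (a : Fin n → A) : q (c a) = H a := by
      have : (c.quotKerEquivOfSurjective hc).symm (c a) = Submodule.Quotient.mk a := by
        rw [LinearEquiv.symm_apply_eq]
        rfl
      change (LinearMap.ker c).liftQ H hker ((c.quotKerEquivOfSurjective hc).symm (c a)) = H a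
      rw [this]
      rfl
    refine ⟨FGModuleCat.ofHom q, fun i => ev_inj z ?_⟩
    change q ((1 : A) • c (Pi.single i 1)) = (h i).hom.hom (1 : A)
    rw [one_smul, hq, hH, Finset.sum_eq_single i]
    · rw [Pi.single_eq_same]
    · intro l _ hl
      rw [Pi.single_eq_of_ne hl]
      exact map_zero (h l).hom.hom
    · simp
  · obtain ⟨a, ha⟩ := hc (ev M s)
    refine ⟨fun i => FGModuleCat.ofHom (LinearMap.toSpanSingleton A A (a i)), ev_inj M ?_⟩
    rw [map_sum, ← ha, hc_sum]
    refine Finset.sum_congr rfl fun i _ => ?_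
    change _ = ((1 : A) • a i) • c (Pi.single i 1)
    rw [one_smul]

theorem IsPresentingObject.of_equivalence {X Y : Type*} [Category* X] [Category* Y]
    [Preadditive X] [Preadditive Y] [HasFiniteBiproducts Y] {p : Y} (hp : IsPresentingObject p)
    (e : Y ≌ X) [e.functor.Additive] : IsPresentingObject (e.functor.obj p) := by
  intro x
  obtain ⟨n, m, g, f, h, hspan⟩ := hp (e.inverse.obj x)
  have hL := h.map e.functor
  let α : e.functor.obj (e.inverse.obj x) ≅ x := e.counitIso.app x
  refine ⟨n, m, fun j i => e.functor.map (g j i), fun i => e.functor.map (f i) ≫ α.hom,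
    ⟨fun j => ?_, fun {z a b} hab => ?_, fun t ht => ?_⟩, fun s => ?_⟩
  · have := hL.rel j =≫ α.hom
    rw [Preadditive.sum_comp, zero_comp] at this
    simpa only [Category.assoc] using this
  · rw [← cancel_epi α.hom]
    exact hL.hom_ext fun i => by simpa using hab i
  · obtain ⟨d, hd⟩ := hL.exists_desc t ht
    exact ⟨α.inv ≫ d, fun i => by simpa using hd i⟩
  · obtain ⟨s', hs'⟩ := e.functor.map_surjective (s ≫ α.inv)
    obtain ⟨r, hr⟩ := hspan s'
    refine ⟨fun i => e.functor.map (r i), ?_⟩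
    rw [← cancel_mono α.inv, ← hs', hr, Functor.map_sum, Preadditive.sum_comp]
    exact Finset.sum_congr rfl fun i _ => by simp

variable {k : Type u} [Field k] (X : FinLinCat.{u, v, w} k)

theorem isNoetherianRing_of_finite (k : Type u) [Field k] (A : Type u) [Ring A] [Algebra k A]
    [Module.Finite k A] : IsNoetherianRing A :=
  isNoetherian_of_tower k (inferInstance : IsNoetherian k A)

theorem exists_isPresentingObject : ∃ p : X, IsPresentingObject p := by
  obtain ⟨A, _, _, _, e, _, _⟩ := IsFiniteLinear.exists_equiv (k := k) (X := X)
  have := isNoetherianRing_of_finite k A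
  have := hasFiniteBiproducts_fgModuleCat A
  have : e.symm.functor.Additive := inferInstanceAs e.inverse.Additive
  exact ⟨_, (isPresentingObject_of A).of_equivalence e.symm⟩

instance hasKernels : HasKernels X := by
  obtain ⟨A, _, _, _, e, _, _⟩ := IsFiniteLinear.exists_equiv (k := k) (X := X)
  have := isNoetherianRing_of_finite k A
  have : HasLimitsOfShape WalkingParallelPair X :=
    Adjunction.hasLimitsOfShape_of_equivalence e.functor
  infer_instance

instance hasCokernels : HasCokernels X := by
  obtain ⟨A, _, _, _, e, _, _⟩ := IsFiniteLinear.exists_equiv (k := k) (X := X)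
  have := isNoetherianRing_of_finite k A
  have : HasColimitsOfShape WalkingParallelPair X :=
    Adjunction.hasColimitsOfShape_of_equivalence e.functor
  infer_instance

end Generator

/-! ### Morphisms into and out of `V ⊗ c` -/

section CopowerHoms

variable {k : Type u} [Field k] {A B : FinLinCat.{u, v, w} k}
variable {V : Type*} [AddCommGroup V] [Module k V] [Module.Finite k V]
variable {V' : Type*} [AddCommGroup V'] [Module k V'] [Module.Finite k V']

/-- The morphism `V ⊗ c ⟶ c` given by contraction with a linear form on `V`. -/
def copower.proj (V : Type*) [AddCommGroup V] [Module k V] [Module.Finite k V] (c : A) :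
    Module.Dual k V →ₗ[k] (copower V c ⟶ c) where
  toFun ξ := copower.desc (LinearMap.smulRight ξ (𝟙 c))
  map_add' ξ ξ' := copower.hom_ext fun v => by simp [add_smul]
  map_smul' r ξ := copower.hom_ext fun v => by simp [mul_smul]

@[simp]
theorem copower.ι_proj (c : A) (v : V) (ξ : Module.Dual k V) :
    copower.ι V c v ≫ copower.proj V c ξ = ξ v • 𝟙 c := by
  simp [copower.proj]

theorem copower.map_proj {c d : A} (f : V →ₗ[k] V') (g : c ⟶ d) (ξ : Module.Dual k V') :
    copower.map f g ≫ copower.proj V' d ξ = copower.proj V c (ξ ∘ₗ f) ≫ g := by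
  refine copower.hom_ext fun v => ?_
  rw [← Category.assoc, copower.ι_map, Category.assoc, copower.ι_proj, ← Category.assoc,
    copower.ι_proj]
  simp

theorem copower.total (V : Type*) [AddCommGroup V] [Module k V] [Module.Finite k V] (c : A) :
    ∑ i, copower.proj V c ((Module.finBasis k V).coord i) ≫
      copower.ι V c (Module.finBasis k V i) = 𝟙 (copower V c) := by
  refine copower.hom_ext fun v => ?_
  rw [Preadditive.comp_sum, Category.comp_id]
  conv_rhs => rw [← (Module.finBasis k V).sum_repr v, map_sum]
  refine Finset.sum_congr rfl fun i _ => ?_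
  rw [← Category.assoc, copower.ι_proj]
  simp

variable (L : A ⥤ B)

section

variable [L.Linear k]

/-- A linear map `V^* → Hom(z, L c)` defines a morphism `z ⟶ L (V ⊗ c)`. -/
theorem copower.exists_lift {c : A} {z : B} (t : Module.Dual k V →ₗ[k] (z ⟶ L.obj c)) :
    ∃ a : z ⟶ L.obj (copower V c), ∀ ξ, a ≫ L.map (copower.proj V c ξ) = t ξ := by
  refine ⟨∑ i, t ((Module.finBasis k V).coord i) ≫
    L.map (copower.ι V c (Module.finBasis k V i)), fun ξ => ?_⟩
  conv_rhs => rw [← (Module.finBasis k V).sum_dual_apply_smul_coord ξ, map_sum]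
  rw [Preadditive.sum_comp]
  refine Finset.sum_congr rfl fun i _ => ?_
  rw [Category.assoc, ← L.map_comp, copower.ι_proj, L.map_smul]
  simp

/-- A linear map `V → Hom(L c, z)` defines a morphism `L (V ⊗ c) ⟶ z`. -/
theorem copower.exists_desc {c : A} {z : B} (t : V →ₗ[k] (L.obj c ⟶ z)) :
    ∃ a : L.obj (copower V c) ⟶ z, ∀ v, L.map (copower.ι V c v) ≫ a = t v := by
  refine ⟨∑ i, L.map (copower.proj V c ((Module.finBasis k V).coord i)) ≫
    t (Module.finBasis k V i), fun v => ?_⟩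
  conv_rhs => rw [← (Module.finBasis k V).sum_repr v, map_sum]
  rw [Preadditive.comp_sum]
  refine Finset.sum_congr rfl fun i _ => ?_
  rw [← Category.assoc, ← L.map_comp, copower.ι_proj, L.map_smul]
  simp

end

variable [L.Additive]

theorem copower.map_total (V : Type*) [AddCommGroup V] [Module k V] [Module.Finite k V] (c : A) :
    ∑ i, L.map (copower.proj V c ((Module.finBasis k V).coord i)) ≫
      L.map (copower.ι V c (Module.finBasis k V i)) = 𝟙 (L.obj (copower V c)) := by
  rw [← L.map_id, ← copower.total V c, L.map_sum]
  simp

/-- An additive functor preserves `V ⊗ c`, here regarded as the object with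
`Hom(z, V ⊗ c) ≅ Hom_k(V^*, Hom(z, c))`: uniqueness. -/
theorem copower.hom_ext_proj {c : A} {z : B} {a b : z ⟶ L.obj (copower V c)}
    (h : ∀ ξ, a ≫ L.map (copower.proj V c ξ) = b ≫ L.map (copower.proj V c ξ)) : a = b := by
  rw [← Category.comp_id a, ← Category.comp_id b, ← copower.map_total L V c,
    Preadditive.comp_sum, Preadditive.comp_sum]
  refine Finset.sum_congr rfl fun i _ => ?_
  rw [← Category.assoc, h, Category.assoc]

/-- An additive functor preserves `V ⊗ c`, here regarded as the object with
`Hom(V ⊗ c, z) ≅ Hom_k(V, Hom(c, z))`: uniqueness. -/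
theorem copower.hom_ext_ι {c : A} {z : B} {a b : L.obj (copower V c) ⟶ z}
    (h : ∀ v, L.map (copower.ι V c v) ≫ a = L.map (copower.ι V c v) ≫ b) : a = b := by
  rw [← Category.id_comp a, ← Category.id_comp b, ← copower.map_total L V c,
    Preadditive.sum_comp, Preadditive.sum_comp]
  refine Finset.sum_congr rfl fun i _ => ?_
  rw [Category.assoc, h, Category.assoc]

theorem copower.hom_ext_proj' {c z : A} {a b : z ⟶ copower V c}
    (h : ∀ ξ, a ≫ copower.proj V c ξ = b ≫ copower.proj V c ξ) : a = b :=
  copower.hom_ext_proj (𝟭 A) h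

end CopowerHoms

/-! ### Linear forms on morphism spaces -/

section DualHom

variable {k : Type u} [Field k] {X : Type*} [Category* X] [Preadditive X] [Linear k X] {ι κ : Type}
  [Fintype ι] {q p x : X} {g : κ → ι → (q ⟶ p)} {f : ι → (p ⟶ x)}

/-- Linear forms on `Hom(x, y)` decompose along the generators of `x`. -/
theorem exists_dual_section (h : IsMatrixCokernel g f) (y : X) :
    ∃ S : ι → Module.Dual k (x ⟶ y) →ₗ[k] Module.Dual k (p ⟶ y),
      ∀ ξ, ∑ i, S i ξ ∘ₗ Linear.leftComp k y (f i) = ξ := by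
  classical
  let α : (x ⟶ y) →ₗ[k] (ι → (p ⟶ y)) := LinearMap.pi fun i => Linear.leftComp k y (f i)
  have hα : LinearMap.ker α = ⊥ := LinearMap.ker_eq_bot.2 fun a b hab =>
    h.hom_ext fun i => congrFun hab i
  obtain ⟨σ, hσ⟩ := α.exists_leftInverse_of_injective hα
  refine ⟨fun i => (σ ∘ₗ LinearMap.single k (fun _ => (p ⟶ y)) i).dualMap, fun ξ => ?_⟩
  ext a
  have ha : σ (α a) = a := LinearMap.congr_fun hσ a
  conv_rhs => rw [← ha, ← Finset.univ_sum_single (α a), map_sum, map_sum]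
  simp [α]

/-- The relations between linear forms on `Hom(p, y)` that hold on `Hom(x, y)` come from the
relations of `x`. -/
theorem exists_dual_lift [Fintype κ] (h : IsMatrixCokernel g f) (y : X) (η : ι → Module.Dual k (p ⟶ y))
    (hη : ∑ i, η i ∘ₗ Linear.leftComp k y (f i) = 0) :
    ∃ ζ : κ → Module.Dual k (q ⟶ y),
      ∀ i, η i = ∑ j, ζ j ∘ₗ Linear.leftComp k y (g j i) := by
  classical
  let β : (ι → (p ⟶ y)) →ₗ[k] (κ → (q ⟶ y)) :=
    LinearMap.pi fun j => ∑ i, Linear.leftComp k y (g j i) ∘ₗ LinearMap.proj i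
  have hβ (a : ι → (p ⟶ y)) (j : κ) : β a j = ∑ i, g j i ≫ a i := by simp [β]
  let H : Module.Dual k (ι → (p ⟶ y)) := ∑ i, η i ∘ₗ LinearMap.proj i
  have hH : H ∈ (LinearMap.ker β).dualAnnihilator := by
    rw [Submodule.mem_dualAnnihilator]
    intro a ha
    obtain ⟨d, hd⟩ := h.exists_desc a fun j => by
      rw [← hβ, LinearMap.mem_ker.1 ha]
      rfl
    have := LinearMap.congr_fun hη d
    simpa [H, hd] using this
  rw [← LinearMap.range_dualMap_eq_dualAnnihilator_ker] at hH
  obtain ⟨Z, hZ⟩ := hH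
  refine ⟨fun j => Z ∘ₗ LinearMap.single k (fun _ => (q ⟶ y)) j, fun i => ?_⟩
  ext a
  have := LinearMap.congr_fun hZ (Pi.single i a)
  have h1 : H (Pi.single i a) = η i a := by
    simp only [H, LinearMap.sum_apply, LinearMap.comp_apply, LinearMap.proj_apply]
    rw [Finset.sum_eq_single i]
    · simp
    · intro b _ hb
      simp [hb]
    · simp
  rw [← h1, ← this, LinearMap.dualMap_apply, ← Finset.univ_sum_single (β (Pi.single i a)), map_sum,
    LinearMap.sum_apply]
  refine Finset.sum_congr rfl fun j _ => ?_
  have h2 : β (Pi.single i a) j = g j i ≫ a := by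
    rw [hβ, Finset.sum_eq_single i]
    · simp
    · intro b _ hb
      simp [hb]
    · simp
  simp [h2]

end DualHom

/-! ### Natural families `Hom(x, y)^* → Hom(z, L x)` -/

section LeftFamily

variable {k : Type u} [Field k] {A B : FinLinCat.{u, v, w} k}

/-- A natural transformation from `x ↦ Hom(x, y)^*` to `x ↦ Hom(z, L x)`, which is the same as a
wedge `z ⟶ Hom(x, y) ⊗ L x`. -/
structure LeftFamily (L : A ⥤ B) (y : A) (z : B) where
  app (x : A) : Module.Dual k (x ⟶ y) →ₗ[k] (z ⟶ L.obj x)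
  naturality {x x' : A} (f : x ⟶ x') (ξ : Module.Dual k (x ⟶ y)) :
    app x ξ ≫ L.map f = app x' (ξ ∘ₗ Linear.leftComp k y f)

namespace LeftFamily

variable {L : A ⥤ B} {y : A} {z : B}

/-- The family on `z'` obtained by precomposition with a morphism `z' ⟶ z`. -/
def comp {z' : B} (h : z' ⟶ z) (θ : LeftFamily L y z) : LeftFamily L y z' where
  app x := Linear.leftComp k _ h ∘ₗ θ.app x
  naturality f ξ := by
    have := θ.naturality f ξ
    simp [this]

/-- The image of a family under a linear functor. -/
def map {E : A} (ρ : LeftFamily (𝟭 A) y E) (L : A ⥤ B) [L.Additive] [L.Linear k] :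
    LeftFamily L y (L.obj E) where
  app x := L.mapLinearMap k ∘ₗ ρ.app x
  naturality f ξ := by
    have := congrArg L.map (ρ.naturality f ξ)
    simpa using this

/-- A universal family exhibits its source as the end `∫_x Hom(x, y) ⊗ L x`. -/
def IsUniversal (ρ : LeftFamily L y z) : Prop :=
  ∀ (z' : B) (θ : LeftFamily L y z'), ∃! h : z' ⟶ z, ∀ x ξ, h ≫ ρ.app x ξ = θ.app x ξ

theorem IsUniversal.hom_ext {ρ : LeftFamily L y z} (hρ : ρ.IsUniversal) {z' : B} {h h' : z' ⟶ z}
    (hh : ∀ x ξ, h ≫ ρ.app x ξ = h' ≫ ρ.app x ξ) : h = h' :=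
  (hρ z' (ρ.comp h')).unique hh fun _ _ => rfl

/-- A family is determined by its component at a presenting object. -/
theorem ext_of_isPresentingObject {p : A} (hp : IsPresentingObject p) {θ θ' : LeftFamily L y z}
    (h : ∀ ξ, θ.app p ξ = θ'.app p ξ) (x : A) (ξ : Module.Dual k (x ⟶ y)) :
    θ.app x ξ = θ'.app x ξ := by
  obtain ⟨n, m, g, f, hf, -⟩ := hp x
  obtain ⟨S, hS⟩ := exists_dual_section (k := k) hf y
  rw [← hS ξ, map_sum, map_sum]
  refine Finset.sum_congr rfl fun i _ => ?_
  rw [← naturality, ← naturality, h]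

variable [L.Additive]

/-- A linear map `Hom(p, y)^* → Hom(z, L p)` compatible with the endomorphisms of a presenting
object `p` extends to a natural family. -/
theorem exists_extension {p : A} (hp : IsPresentingObject p)
    (t : Module.Dual k (p ⟶ y) →ₗ[k] (z ⟶ L.obj p))
    (ht : ∀ (g : p ⟶ p) (ξ : Module.Dual k (p ⟶ y)),
      t ξ ≫ L.map g = t (ξ ∘ₗ Linear.leftComp k y g)) :
    ∃ θ : LeftFamily L y z, ∀ ξ, θ.app p ξ = t ξ := by
  choose n m g f hf hspan using hp
  choose S hS using fun x => exists_dual_section (k := k) (hf x) y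
  let θ (x : A) : Module.Dual k (x ⟶ y) →ₗ[k] (z ⟶ L.obj x) :=
    ∑ i, Linear.rightComp k z (L.map (f x i)) ∘ₗ t ∘ₗ S x i
  have hθ (x : A) (ξ) : θ x ξ = ∑ i, t (S x i ξ) ≫ L.map (f x i) := by simp [θ]
  -- the value does not depend on the decomposition of the linear form
  have key (x : A) (η : Fin (n x) → Module.Dual k (p ⟶ y))
      (hη : ∑ i, η i ∘ₗ Linear.leftComp k y (f x i) = 0) :
      ∑ i, t (η i) ≫ L.map (f x i) = 0 := by
    obtain ⟨ζ, hζ⟩ := exists_dual_lift (k := k) (hf x) y η hη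
    have (i : Fin (n x)) : t (η i) ≫ L.map (f x i) = ∑ j, t (ζ j) ≫ L.map (g x j i ≫ f x i) := by
      rw [hζ, map_sum, Preadditive.sum_comp]
      refine Finset.sum_congr rfl fun j _ => ?_
      rw [← ht, Category.assoc, L.map_comp]
    rw [Finset.sum_congr rfl fun i _ => this i, Finset.sum_comm]
    refine Finset.sum_eq_zero fun j _ => ?_
    rw [← Preadditive.comp_sum, ← L.map_sum, (hf x).rel j, L.map_zero, comp_zero]
  have hcomp (x : A) (s : p ⟶ x) (ξ : Module.Dual k (p ⟶ y)) :
      θ x (ξ ∘ₗ Linear.leftComp k y s) = t ξ ≫ L.map s := by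
    obtain ⟨r, hr⟩ := hspan x s
    have hsum : t ξ ≫ L.map s = ∑ i, t (ξ ∘ₗ Linear.leftComp k y (r i)) ≫ L.map (f x i) := by
      conv_lhs => rw [hr, L.map_sum, Preadditive.comp_sum]
      refine Finset.sum_congr rfl fun i _ => ?_
      rw [← ht, L.map_comp, Category.assoc]
    rw [hθ, hsum, ← sub_eq_zero, ← Finset.sum_sub_distrib]
    simp only [← Preadditive.sub_comp, ← map_sub]
    refine key x _ ?_
    simp only [LinearMap.sub_comp, Finset.sum_sub_distrib]
    rw [hS, sub_eq_zero]
    ext a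
    simp only [LinearMap.comp_apply, LinearMap.sum_apply, Linear.leftComp_apply]
    rw [← map_sum]
    congr 1
    conv_lhs => rw [hr, Preadditive.sum_comp]
    simp
  refine ⟨⟨θ, fun {x x'} s ξ => ?_⟩, fun ξ => ?_⟩
  · conv_rhs => rw [← hS x ξ]
    rw [hθ, Preadditive.sum_comp]
    have (i : Fin (n x)) : (S x i ξ ∘ₗ Linear.leftComp k y (f x i)) ∘ₗ Linear.leftComp k y s =
        S x i ξ ∘ₗ Linear.leftComp k y (f x i ≫ s) := by
      ext a
      simp
    rw [show (∑ i, S x i ξ ∘ₗ Linear.leftComp k y (f x i)) ∘ₗ Linear.leftComp k y s =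
        ∑ i, (S x i ξ ∘ₗ Linear.leftComp k y (f x i)) ∘ₗ Linear.leftComp k y s by
      ext a; simp, map_sum]
    refine Finset.sum_congr rfl fun i _ => ?_
    rw [this, hcomp, L.map_comp, Category.assoc]
  · have := hcomp p (𝟙 p) ξ
    rw [L.map_id, Category.comp_id] at this
    rw [← this]
    congr 1
    ext a
    simp

variable (y) in
/-- The difference of the two actions of an endomorphism `g` of `p` on `Hom(p, y) ⊗ p`. -/
def balance {p : A} (g : p ⟶ p) : copower (p ⟶ y) p ⟶ copower (p ⟶ y) p :=
  copower.map LinearMap.id g - copower.map (Linear.leftComp k y g) (𝟙 p)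

variable [L.Linear k]

/-- A morphism `z ⟶ L (Hom(p, y) ⊗ p)` equalizes the actions of a basis of `End(p)` if and only if
the corresponding linear map `Hom(p, y)^* → Hom(z, L p)` is compatible with `End(p)`. -/
theorem balance_condition {p : A} {a : z ⟶ L.obj (copower (p ⟶ y) p)} :
    (∀ j, a ≫ L.map (balance y (Module.finBasis k (p ⟶ p) j)) = 0) ↔
      ∀ (g : p ⟶ p) (ξ : Module.Dual k (p ⟶ y)),
        (a ≫ L.map (copower.proj _ p ξ)) ≫ L.map g =
          a ≫ L.map (copower.proj _ p (ξ ∘ₗ Linear.leftComp k y g)) := by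
  have hpr (g : p ⟶ p) (ξ : Module.Dual k (p ⟶ y)) : balance y g ≫ copower.proj _ p ξ =
      copower.proj _ p ξ ≫ g - copower.proj _ p (ξ ∘ₗ Linear.leftComp k y g) := by
    rw [balance, Preadditive.sub_comp, copower.map_proj, copower.map_proj, Category.comp_id]
    rfl
  have hg (g : p ⟶ p) : a ≫ L.map (balance y g) = 0 ↔ ∀ ξ : Module.Dual k (p ⟶ y),
        (a ≫ L.map (copower.proj _ p ξ)) ≫ L.map g =
          a ≫ L.map (copower.proj _ p (ξ ∘ₗ Linear.leftComp k y g)) := by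
    constructor
    · intro h ξ
      have := h =≫ L.map (copower.proj _ p ξ)
      rw [Category.assoc, ← L.map_comp, hpr, L.map_sub, Preadditive.comp_sub, zero_comp,
        sub_eq_zero, L.map_comp] at this
      rw [Category.assoc, this]
    · intro h
      refine copower.hom_ext_proj L fun ξ => ?_
      rw [Category.assoc, ← L.map_comp, hpr, L.map_sub, Preadditive.comp_sub, zero_comp,
        sub_eq_zero, L.map_comp, ← h, Category.assoc]
  have leftComp_add (g g' : p ⟶ p) :
      Linear.leftComp k y (g + g') = Linear.leftComp k y g + Linear.leftComp k y g' := by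
    ext a; simp
  have leftComp_smul (r : k) (g : p ⟶ p) :
      Linear.leftComp k y (r • g) = r • Linear.leftComp k y g := by
    ext a; simp
  let β : (p ⟶ p) →ₗ[k] (z ⟶ L.obj (copower (p ⟶ y) p)) :=
    { toFun := fun g => a ≫ L.map (balance y g)
      map_add' := fun g g' => by
        rw [← Preadditive.comp_add, ← L.map_add]
        congr 2
        refine copower.hom_ext_proj' fun ξ => ?_
        simp only [Preadditive.add_comp, hpr, Preadditive.comp_add,
          leftComp_add, LinearMap.comp_add, map_add]
        abel
      map_smul' := fun r g => by
        rw [RingHom.id_apply, ← Linear.comp_smul, ← L.map_smul]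
        congr 2
        refine copower.hom_ext_proj' fun ξ => ?_
        simp only [Linear.smul_comp, hpr, Linear.comp_smul,
          leftComp_smul, LinearMap.comp_smul, map_smul, smul_sub] }
  refine Iff.trans ?_ (forall_congr' hg)
  constructor
  · intro h g
    have : β = 0 := (Module.finBasis k (p ⟶ p)).ext fun j => h j
    exact LinearMap.congr_fun this g
  · exact fun h j => h _

/-- The end of `Hom(x, y) ⊗ L x` is the joint kernel of the two actions of `End(p)` on the component
at a presenting object `p`. -/
theorem isUniversal_of_isJointKernel {p : A} (hp : IsPresentingObject p)
    {e : z ⟶ L.obj (copower (p ⟶ y) p)}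
    (he : IsJointKernel e fun j => L.map (balance y (Module.finBasis k (p ⟶ p) j)))
    {ρ : LeftFamily L y z} (hρ : ∀ ξ, ρ.app p ξ = e ≫ L.map (copower.proj _ p ξ)) :
    ρ.IsUniversal := by
  intro z' θ
  obtain ⟨a, ha⟩ := copower.exists_lift L (θ.app p)
  obtain ⟨h, hh⟩ := he.exists_lift a
    (balance_condition.2 fun g ξ => by rw [ha, ha]; exact θ.naturality g ξ)
  refine ⟨h, ?_, fun h' hh' => he.hom_ext (copower.hom_ext_proj L fun ξ => ?_)⟩
  · refine ext_of_isPresentingObject (θ := ρ.comp h) hp fun ξ => ?_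
    rw [← ha, ← hh, Category.assoc, ← hρ]
    rfl
  · rw [Category.assoc, ← hρ, hh', hh, ha]

theorem exists_of_isJointKernel {p : A} (hp : IsPresentingObject p)
    {e : z ⟶ L.obj (copower (p ⟶ y) p)}
    (he : IsJointKernel e fun j => L.map (balance y (Module.finBasis k (p ⟶ p) j))) :
    ∃ ρ : LeftFamily L y z, ∀ ξ, ρ.app p ξ = e ≫ L.map (copower.proj _ p ξ) :=
  exists_extension hp (Linear.leftComp k _ e ∘ₗ L.mapLinearMap k ∘ₗ copower.proj _ p)
    fun g ξ => balance_condition.1 he.rel g ξ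

theorem IsUniversal.exists_isJointKernel {p : A} (hp : IsPresentingObject p)
    {ρ : LeftFamily L y z} (hρ : ρ.IsUniversal) :
    ∃ e : z ⟶ L.obj (copower (p ⟶ y) p), (∀ ξ, e ≫ L.map (copower.proj _ p ξ) = ρ.app p ξ) ∧
      IsJointKernel e fun j => L.map (balance y (Module.finBasis k (p ⟶ p) j)) := by
  obtain ⟨e, he⟩ := copower.exists_lift L (ρ.app p)
  refine ⟨e, he, balance_condition.2 fun g ξ => by rw [he, he]; exact ρ.naturality g ξ,
    fun {z' h h'} hh => hρ.hom_ext ?_, fun {z'} a ha => ?_⟩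
  · refine ext_of_isPresentingObject (θ := ρ.comp h) (θ' := ρ.comp h') hp fun ξ => ?_
    change h ≫ ρ.app p ξ = h' ≫ ρ.app p ξ
    rw [← he, reassoc_of% hh]
  · obtain ⟨θ, hθ⟩ := exists_extension hp
      (Linear.leftComp k _ a ∘ₗ L.mapLinearMap k ∘ₗ copower.proj _ p)
      fun g ξ => balance_condition.1 ha g ξ
    obtain ⟨h, hh, -⟩ := hρ z' θ
    refine ⟨h, copower.hom_ext_proj L fun ξ => ?_⟩
    rw [Category.assoc, he, hh, hθ]
    rfl

/-- The ends `∫_x Hom(x, y) ⊗ x` exist: they are finite limits, because it suffices to let `x` run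
over the endomorphisms of a presenting object. -/
theorem exists_isUniversal (y : A) : ∃ (E : A) (ρ : LeftFamily (𝟭 A) y E), ρ.IsUniversal := by
  obtain ⟨p, hp⟩ := exists_isPresentingObject A
  obtain ⟨E, e, he⟩ := exists_isJointKernel fun j => balance y (Module.finBasis k (p ⟶ p) j)
  obtain ⟨ρ, hρ⟩ := exists_of_isJointKernel (L := 𝟭 A) hp he
  exact ⟨E, ρ, isUniversal_of_isJointKernel (L := 𝟭 A) hp he hρ⟩

/-- A left exact linear functor preserves the ends `∫_x Hom(x, y) ⊗ x`. -/
theorem IsUniversal.map {E : A} {ρ : LeftFamily (𝟭 A) y E} (hρ : ρ.IsUniversal)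
    (L : A ⥤ B) [L.Additive] [L.Linear k] [PreservesFiniteLimits L] : (ρ.map L).IsUniversal := by
  obtain ⟨p, hp⟩ := exists_isPresentingObject A
  obtain ⟨e, he, hker⟩ := hρ.exists_isJointKernel hp
  refine isUniversal_of_isJointKernel hp (IsJointKernel.map hker L) fun ξ => ?_
  rw [← L.map_comp]
  exact congrArg L.map (he ξ).symm

end LeftFamily

end LeftFamily

/-! ### Natural families `Hom(y, x)^* → Hom(L x, z)` -/

section RightFamily

variable {k : Type u} [Field k] {A B : FinLinCat.{u, v, w} k}

/-- A natural transformation from `x ↦ Hom(y, x)^*` to `x ↦ Hom(L x, z)`, which is the same as a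
cowedge `Hom(y, x)^* ⊗ L x ⟶ z`. -/
structure RightFamily (L : A ⥤ B) (y : A) (z : B) where
  app (x : A) : Module.Dual k (y ⟶ x) →ₗ[k] (L.obj x ⟶ z)
  naturality {x x' : A} (f : x ⟶ x') (ξ : Module.Dual k (y ⟶ x')) :
    L.map f ≫ app x' ξ = app x (ξ ∘ₗ Linear.rightComp k y f)

namespace RightFamily

variable {L : A ⥤ B} {y : A} {z : B}

/-- The family on `z'` obtained by composition with a morphism `z ⟶ z'`. -/
def comp {z' : B} (θ : RightFamily L y z) (h : z ⟶ z') : RightFamily L y z' where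
  app x := Linear.rightComp k _ h ∘ₗ θ.app x
  naturality f ξ := by
    have := θ.naturality f ξ
    simp [← this]

/-- The image of a family under a linear functor. -/
def map {E : A} (ρ : RightFamily (𝟭 A) y E) (L : A ⥤ B) [L.Additive] [L.Linear k] :
    RightFamily L y (L.obj E) where
  app x := L.mapLinearMap k ∘ₗ ρ.app x
  naturality f ξ := by
    have := congrArg L.map (ρ.naturality f ξ)
    simpa using this

/-- A universal family exhibits its target as the coend `∫^x Hom(y, x)^* ⊗ L x`. -/
def IsUniversal (ρ : RightFamily L y z) : Prop :=
  ∀ (z' : B) (θ : RightFamily L y z'), ∃! h : z ⟶ z', ∀ x ξ, ρ.app x ξ ≫ h = θ.app x ξ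

theorem IsUniversal.hom_ext {ρ : RightFamily L y z} (hρ : ρ.IsUniversal) {z' : B} {h h' : z ⟶ z'}
    (hh : ∀ x ξ, ρ.app x ξ ≫ h = ρ.app x ξ ≫ h') : h = h' :=
  (hρ z' (ρ.comp h')).unique hh fun _ _ => rfl

variable [L.Additive]

section RightExact

variable [PreservesFiniteColimits L]

/-- A family with values in a right exact functor is determined by its component at a presenting
object. -/
theorem ext_of_isPresentingObject {p : A} (hp : IsPresentingObject p) {θ θ' : RightFamily L y z}
    (h : ∀ ξ, θ.app p ξ = θ'.app p ξ) (x : A) (ξ : Module.Dual k (y ⟶ x)) :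
    θ.app x ξ = θ'.app x ξ := by
  obtain ⟨n, m, g, f, hf, -⟩ := hp x
  refine (hf.map L).hom_ext fun i => ?_
  rw [naturality, naturality, h]

/-- A linear map `Hom(y, p)^* → Hom(L p, z)` compatible with the endomorphisms of a presenting
object `p` extends to a natural family, because `L x` is a cokernel of a matrix between copies of
`L p`. -/
theorem exists_extension {p : A} (hp : IsPresentingObject p)
    (t : Module.Dual k (y ⟶ p) →ₗ[k] (L.obj p ⟶ z))
    (ht : ∀ (g : p ⟶ p) (ξ : Module.Dual k (y ⟶ p)),
      L.map g ≫ t ξ = t (ξ ∘ₗ Linear.rightComp k y g)) :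
    ∃ θ : RightFamily L y z, ∀ ξ, θ.app p ξ = t ξ := by
  have key (x : A) (ξ : Module.Dual k (y ⟶ x)) :
      ∃ d : L.obj x ⟶ z, ∀ s : p ⟶ x, L.map s ≫ d = t (ξ ∘ₗ Linear.rightComp k y s) := by
    obtain ⟨n, m, g, f, hf, hspan⟩ := hp x
    have comb (r : Fin n → (p ⟶ p)) :
        ∑ i, L.map (r i) ≫ t (ξ ∘ₗ Linear.rightComp k y (f i)) =
          t (ξ ∘ₗ Linear.rightComp k y (∑ i, r i ≫ f i)) := by
      simp only [ht]
      rw [← map_sum]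
      congr 1
      ext a
      simp [Preadditive.comp_sum]
    obtain ⟨d, hd⟩ := (hf.map L).exists_desc
      (fun i => t (ξ ∘ₗ Linear.rightComp k y (f i))) fun j => by
        rw [comb, hf.rel j]
        have : ξ ∘ₗ Linear.rightComp k y (0 : p ⟶ x) = 0 := by
          ext a
          simp
        rw [this, map_zero]
    refine ⟨d, fun s => ?_⟩
    obtain ⟨r, rfl⟩ := hspan s
    rw [← comb, L.map_sum, Preadditive.sum_comp]
    refine Finset.sum_congr rfl fun i _ => ?_
    rw [L.map_comp, Category.assoc, hd]
  have ext (x : A) {d d' : L.obj x ⟶ z} (h : ∀ s : p ⟶ x, L.map s ≫ d = L.map s ≫ d') :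
      d = d' := by
    obtain ⟨n, m, g, f, hf, -⟩ := hp x
    exact (hf.map L).hom_ext fun i => h (f i)
  choose d hd using key
  refine ⟨⟨fun x => ⟨⟨d x, fun ξ ξ' => ext x fun s => ?_⟩, fun r ξ => ext x fun s => ?_⟩,
    fun {x x'} f ξ => ext x fun s => ?_⟩, fun ξ => ?_⟩
  · rw [Preadditive.comp_add, hd, hd, hd, LinearMap.add_comp, map_add]
  · rw [Linear.comp_smul]
    dsimp only
    rw [hd, RingHom.id_apply, hd, LinearMap.smul_comp, map_smul]
  · change L.map s ≫ L.map f ≫ d x' ξ = L.map s ≫ d x _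
    rw [← L.map_comp_assoc, hd, hd]
    congr 1
    ext a
    simp
  · change d p ξ = t ξ
    have := hd p ξ (𝟙 p)
    rw [L.map_id, Category.id_comp] at this
    rw [this]
    congr 1
    ext a
    simp

end RightExact

variable (y) in
/-- The difference of the two actions of an endomorphism `g` of `p` on `Hom(y, p)^* ⊗ p`. -/
def balance {p : A} (g : p ⟶ p) :
    copower (Module.Dual k (y ⟶ p)) p ⟶ copower (Module.Dual k (y ⟶ p)) p :=
  copower.map (Linear.rightComp k y g).dualMap (𝟙 p) - copower.map LinearMap.id g

variable [L.Linear k]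

/-- A morphism `L (Hom(y, p)^* ⊗ p) ⟶ z` coequalizes the actions of a basis of `End(p)` if and only
if the corresponding linear map `Hom(y, p)^* → Hom(L p, z)` is compatible with `End(p)`. -/
theorem balance_condition {p : A} {a : L.obj (copower (Module.Dual k (y ⟶ p)) p) ⟶ z} :
    (∀ j, L.map (balance y (Module.finBasis k (p ⟶ p) j)) ≫ a = 0) ↔
      ∀ (g : p ⟶ p) (ξ : Module.Dual k (y ⟶ p)),
        L.map g ≫ L.map (copower.ι _ p ξ) ≫ a =
          L.map (copower.ι _ p (ξ ∘ₗ Linear.rightComp k y g)) ≫ a := by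
  have hι (g : p ⟶ p) (ξ : Module.Dual k (y ⟶ p)) : copower.ι _ p ξ ≫ balance y g =
      copower.ι _ p (ξ ∘ₗ Linear.rightComp k y g) - g ≫ copower.ι _ p ξ := by
    rw [balance, Preadditive.comp_sub, copower.ι_map, copower.ι_map, Category.id_comp]
    rfl
  have hg (g : p ⟶ p) : L.map (balance y g) ≫ a = 0 ↔ ∀ ξ : Module.Dual k (y ⟶ p),
        L.map g ≫ L.map (copower.ι _ p ξ) ≫ a =
          L.map (copower.ι _ p (ξ ∘ₗ Linear.rightComp k y g)) ≫ a := by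
    constructor
    · intro h ξ
      have := L.map (copower.ι _ p ξ) ≫= h
      rw [← L.map_comp_assoc, hι, L.map_sub, Preadditive.sub_comp, comp_zero,
        sub_eq_zero, L.map_comp, Category.assoc] at this
      exact this.symm
    · intro h
      refine copower.hom_ext_ι L fun ξ => ?_
      rw [← L.map_comp_assoc, hι, L.map_sub, Preadditive.sub_comp, comp_zero,
        sub_eq_zero, L.map_comp, ← h, Category.assoc]
  have rightComp_add (g g' : p ⟶ p) :
      Linear.rightComp k y (g + g') = Linear.rightComp k y g + Linear.rightComp k y g' := by
    ext a; simp
  have rightComp_smul (r : k) (g : p ⟶ p) :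
      Linear.rightComp k y (r • g) = r • Linear.rightComp k y g := by
    ext a; simp
  let β : (p ⟶ p) →ₗ[k] (L.obj (copower (Module.Dual k (y ⟶ p)) p) ⟶ z) :=
    { toFun := fun g => L.map (balance y g) ≫ a
      map_add' := fun g g' => by
        rw [← Preadditive.add_comp, ← L.map_add]
        congr 2
        refine copower.hom_ext fun ξ => ?_
        simp only [Preadditive.add_comp, hι, Preadditive.comp_add,
          rightComp_add, LinearMap.comp_add, map_add]
        abel
      map_smul' := fun r g => by
        rw [RingHom.id_apply, ← Linear.smul_comp, ← L.map_smul]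
        congr 2
        refine copower.hom_ext fun ξ => ?_
        simp only [Linear.smul_comp, hι, Linear.comp_smul,
          rightComp_smul, LinearMap.comp_smul, map_smul, smul_sub] }
  refine Iff.trans ?_ (forall_congr' hg)
  constructor
  · intro h g
    have : β = 0 := (Module.finBasis k (p ⟶ p)).ext fun j => h j
    exact LinearMap.congr_fun this g
  · exact fun h j => h _

variable [PreservesFiniteColimits L]

/-- The coend of `Hom(y, x)^* ⊗ L x` is the joint cokernel of the two actions of `End(p)` on the
component at a presenting object `p`. -/
theorem isUniversal_of_isMatrixCokernel {p : A} (hp : IsPresentingObject p)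
    {e : L.obj (copower (Module.Dual k (y ⟶ p)) p) ⟶ z}
    (he : IsMatrixCokernel (fun j (_ : Unit) => L.map (balance y (Module.finBasis k (p ⟶ p) j)))
      fun _ => e)
    {ρ : RightFamily L y z} (hρ : ∀ ξ, ρ.app p ξ = L.map (copower.ι _ p ξ) ≫ e) :
    ρ.IsUniversal := by
  intro z' θ
  obtain ⟨a, ha⟩ := copower.exists_desc L (θ.app p)
  have hbal := balance_condition.2 fun g ξ => by rw [ha, ha]; exact θ.naturality g ξ
  obtain ⟨h, hh⟩ := he.exists_desc (fun _ => a) fun j => by simpa using hbal j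
  refine ⟨h, ?_, fun h' hh' => he.hom_ext fun i => copower.hom_ext_ι L fun ξ => ?_⟩
  · refine ext_of_isPresentingObject (θ := ρ.comp h) hp fun ξ => ?_
    rw [← ha, ← hh (), ← Category.assoc, ← hρ]
    rfl
  · rw [← Category.assoc, ← hρ, hh', hh i, ha]

theorem exists_of_isMatrixCokernel {p : A} (hp : IsPresentingObject p)
    {e : L.obj (copower (Module.Dual k (y ⟶ p)) p) ⟶ z}
    (he : IsMatrixCokernel (fun j (_ : Unit) => L.map (balance y (Module.finBasis k (p ⟶ p) j)))
      fun _ => e) :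
    ∃ ρ : RightFamily L y z, ∀ ξ, ρ.app p ξ = L.map (copower.ι _ p ξ) ≫ e :=
  exists_extension hp (Linear.rightComp k _ e ∘ₗ L.mapLinearMap k ∘ₗ copower.ι _ p)
    fun g ξ => balance_condition.1 (fun j => by simpa using he.rel j) g ξ

theorem IsUniversal.exists_isMatrixCokernel {p : A} (hp : IsPresentingObject p)
    {ρ : RightFamily L y z} (hρ : ρ.IsUniversal) :
    ∃ e : L.obj (copower (Module.Dual k (y ⟶ p)) p) ⟶ z,
      (∀ ξ, L.map (copower.ι _ p ξ) ≫ e = ρ.app p ξ) ∧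
      IsMatrixCokernel (fun j (_ : Unit) => L.map (balance y (Module.finBasis k (p ⟶ p) j)))
        fun _ => e := by
  obtain ⟨e, he⟩ := copower.exists_desc L (ρ.app p)
  have hbal := balance_condition.2 fun g ξ => by rw [he, he]; exact ρ.naturality g ξ
  refine ⟨e, he, fun j => by simpa using hbal j,
    fun {z' h h'} hh => hρ.hom_ext ?_, fun {z'} a ha => ?_⟩
  · refine ext_of_isPresentingObject (θ := ρ.comp h) (θ' := ρ.comp h') hp fun ξ => ?_
    change ρ.app p ξ ≫ h = ρ.app p ξ ≫ h'
    rw [← he, Category.assoc, hh (), Category.assoc]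
  · obtain ⟨θ, hθ⟩ := exists_extension hp
      (Linear.rightComp k _ (a ()) ∘ₗ L.mapLinearMap k ∘ₗ copower.ι _ p)
      fun g ξ => balance_condition.1 (fun j => by simpa using ha j) g ξ
    obtain ⟨h, hh, -⟩ := hρ z' θ
    refine ⟨h, fun i => copower.hom_ext_ι L fun ξ => ?_⟩
    rw [← Category.assoc, he, hh, hθ]
    rfl

/-- The coends `∫^x Hom(y, x)^* ⊗ x` exist: they are finite colimits, because it suffices to let
`x` run over the endomorphisms of a presenting object. -/
theorem exists_isUniversal (y : A) : ∃ (E : A) (ρ : RightFamily (𝟭 A) y E), ρ.IsUniversal := by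
  obtain ⟨p, hp⟩ := exists_isPresentingObject A
  obtain ⟨E, e, he⟩ := exists_isMatrixCokernel fun j => balance y (Module.finBasis k (p ⟶ p) j)
  obtain ⟨ρ, hρ⟩ := exists_of_isMatrixCokernel (L := 𝟭 A) hp he
  exact ⟨E, ρ, isUniversal_of_isMatrixCokernel (L := 𝟭 A) hp he hρ⟩

/-- A right exact linear functor preserves the coends `∫^x Hom(y, x)^* ⊗ x`. -/
theorem IsUniversal.map {E : A} {ρ : RightFamily (𝟭 A) y E} (hρ : ρ.IsUniversal)
    (L : A ⥤ B) [L.Additive] [L.Linear k] [PreservesFiniteColimits L] :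
    (ρ.map L).IsUniversal := by
  obtain ⟨p, hp⟩ := exists_isPresentingObject A
  obtain ⟨e, he, hcoker⟩ := hρ.exists_isMatrixCokernel hp
  refine isUniversal_of_isMatrixCokernel hp (IsMatrixCokernel.map hcoker L) fun ξ => ?_
  rw [← L.map_comp]
  exact congrArg L.map (he ξ).symm

end RightFamily

end RightFamily

/-! ### The Nakayama functors in terms of universal families -/

section NakayamaFamilies

variable {k : Type u} [Field k] {X : FinLinCat.{u, v, w} k}

namespace LeftFamily

/-- The natural family corresponding to a wedge `z ⟶ Hom(x, y) ⊗ x`. -/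
def ofDinatural {y z : X} (t : ∀ x : X, z ⟶ copower (x ⟶ y) x)
    (ht : ∀ {x x' : X} (f : x ⟶ x'), t x ≫ copower.map (LinearMap.id : (x ⟶ y) →ₗ[k] _) f =
      t x' ≫ copower.map (Linear.leftComp k y f) (𝟙 x')) : LeftFamily (𝟭 X) y z where
  app x := Linear.leftComp k x (t x) ∘ₗ copower.proj (x ⟶ y) x
  naturality {x x'} f ξ := by
    have h := ht f =≫ copower.proj (x ⟶ y) x' ξ
    rw [Category.assoc, Category.assoc, copower.map_proj, copower.map_proj,
      Category.comp_id] at h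
    exact (Category.assoc _ _ _).trans h

/-- Every natural family with values in the identity functor comes from a wedge. -/
theorem exists_dinatural {y z : X} (θ : LeftFamily (𝟭 X) y z) :
    ∃ t : ∀ x : X, z ⟶ copower (x ⟶ y) x,
      (∀ {x x' : X} (f : x ⟶ x'), t x ≫ copower.map (LinearMap.id : (x ⟶ y) →ₗ[k] _) f =
        t x' ≫ copower.map (Linear.leftComp k y f) (𝟙 x')) ∧
      ∀ (x : X) (ξ : Module.Dual k (x ⟶ y)), t x ≫ copower.proj (x ⟶ y) x ξ = θ.app x ξ := by
  have (x : X) : ∃ a : z ⟶ copower (x ⟶ y) x,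
      ∀ ξ, a ≫ copower.proj (x ⟶ y) x ξ = θ.app x ξ := copower.exists_lift (𝟭 X) (θ.app x)
  choose t ht using this
  refine ⟨t, fun {x x'} f => ?_, ht⟩
  refine copower.hom_ext_proj' fun ξ => ?_
  rw [Category.assoc, Category.assoc, copower.map_proj, copower.map_proj, Category.comp_id, ht,
    ← Category.assoc, ht]
  exact θ.naturality f ξ

end LeftFamily

namespace RightFamily

/-- The natural family corresponding to a cowedge `Hom(y, x)^* ⊗ x ⟶ z`. -/
def ofDinatural {y z : X} (t : ∀ x : X, copower (Module.Dual k (y ⟶ x)) x ⟶ z)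
    (ht : ∀ {x x' : X} (f : x ⟶ x'),
      copower.map (Linear.rightComp k y f).dualMap (𝟙 x) ≫ t x =
        copower.map (LinearMap.id : Module.Dual k (y ⟶ x') →ₗ[k] _) f ≫ t x') :
    RightFamily (𝟭 X) y z where
  app x := Linear.rightComp k x (t x) ∘ₗ copower.ι _ x
  naturality {x x'} f ξ := by
    have h := copower.ι _ x ξ ≫= ht f
    rw [← Category.assoc, ← Category.assoc, copower.ι_map, copower.ι_map,
      Category.id_comp, Category.assoc] at h
    exact h.symm

theorem desc_dinatural {y z : X} (θ : RightFamily (𝟭 X) y z) {x x' : X} (f : x ⟶ x') :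
    copower.map (Linear.rightComp k y f).dualMap (𝟙 x) ≫
        (copower.desc (θ.app x) : copower (Module.Dual k (y ⟶ x)) x ⟶ z) =
      copower.map (LinearMap.id : Module.Dual k (y ⟶ x') →ₗ[k] _) f ≫
        (copower.desc (θ.app x') : copower (Module.Dual k (y ⟶ x')) x' ⟶ z) := by
  refine copower.hom_ext fun ξ => ?_
  rw [← Category.assoc, ← Category.assoc, copower.ι_map, copower.ι_map, Category.id_comp,
    Category.assoc]
  refine (copower.ι_desc _ _).trans (Eq.trans ?_ (congrArg (f ≫ ·) (copower.ι_desc _ _)).symm)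
  exact (θ.naturality f ξ).symm

end RightFamily

namespace LeftNakayama

variable (N : LeftNakayama X)

/-- The universal dinatural family of the end `∫_x Hom(x, y) ⊗ x`, as a natural family. -/
def family (y : X) : LeftFamily (𝟭 X) y (N.functor.obj y) :=
  LeftFamily.ofDinatural (N.π y) (N.π_dinatural y)

theorem family_isUniversal (y : X) : (N.family y).IsUniversal := by
  intro z θ
  obtain ⟨t, hdin, ht⟩ := θ.exists_dinatural
  have hlift (x : X) : Wedge.IsLimit.lift (N.isLimit y) t (fun x x' f => hdin f) ≫ N.π y x = t x :=
    Wedge.IsLimit.lift_ι (N.isLimit y) t (fun x x' f => hdin f) x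
  refine ⟨Wedge.IsLimit.lift (N.isLimit y) t fun x x' f => hdin f, fun x ξ => ?_,
    fun h hh => N.hom_ext fun x => (Eq.trans ?_ (hlift x).symm)⟩
  · rw [← ht, ← hlift]
    exact (Category.assoc _ _ _).symm
  · refine copower.hom_ext_proj' fun ξ => ?_
    rw [ht]
    exact (Category.assoc _ _ _).trans (hh x ξ)

theorem map_family {y y' : X} (g : y ⟶ y') (x : X) (ξ : Module.Dual k (x ⟶ y')) :
    N.functor.map g ≫ (N.family y').app x ξ = (N.family y).app x (ξ ∘ₗ Linear.rightComp k x g) := by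
  have h := N.map_π g x =≫ copower.proj (x ⟶ y') x ξ
  rw [Category.assoc, Category.assoc, copower.map_proj, Category.comp_id] at h
  exact h

end LeftNakayama

theorem nonempty_leftNakayama (X : FinLinCat.{u, v, w} k) : Nonempty (LeftNakayama X) := by
  choose E ρ hρ using fun y : X => LeftFamily.exists_isUniversal y
  choose t hdin ht using fun y => (ρ y).exists_dinatural
  let θ (y : X) (s : Wedge (homCopower y)) : LeftFamily (𝟭 X) y s.pt :=
    LeftFamily.ofDinatural s.ι fun f => Wedge.condition s f
  refine ⟨⟨fun y => Wedge.mk (E y) (t y) fun x x' f => hdin y f,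
    fun y => Multifork.IsLimit.mk _ (fun s => (hρ y s.pt (θ y s)).choose)
      (fun s x => ?_) (fun s m hm => ?_)⟩⟩
  · refine copower.hom_ext_proj' fun ξ => ?_
    refine (Category.assoc _ _ _).trans ?_
    refine (congrArg ((hρ y s.pt (θ y s)).choose ≫ ·) (ht y x ξ)).trans ?_
    exact (hρ y s.pt (θ y s)).choose_spec.1 x ξ
  · refine (hρ y s.pt (θ y s)).choose_spec.2 m fun x ξ => ?_
    refine (congrArg (m ≫ ·) (ht y x ξ).symm).trans ((Category.assoc _ _ _).symm.trans ?_)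
    exact congrArg (· ≫ copower.proj (x ⟶ y) x ξ) (hm x)

namespace RightNakayama

variable (N : RightNakayama X)

/-- The universal dinatural family of the coend `∫^x Hom(y, x)^* ⊗ x`, as a natural family. -/
def family (y : X) : RightFamily (𝟭 X) y (N.functor.obj y) :=
  RightFamily.ofDinatural (N.ι y) (N.ι_dinatural y)

theorem family_isUniversal (y : X) : (N.family y).IsUniversal := by
  intro z θ
  have hdesc (x : X) : N.ι y x ≫ Cowedge.IsColimit.desc (N.isColimit y)
      (fun x => copower.desc (θ.app x)) (fun x x' f => θ.desc_dinatural f) =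
        copower.desc (θ.app x) :=
    Cowedge.IsColimit.π_desc (N.isColimit y) _ (fun x x' f => θ.desc_dinatural f) x
  refine ⟨Cowedge.IsColimit.desc (N.isColimit y) (fun x => copower.desc (θ.app x))
    fun x x' f => θ.desc_dinatural f, fun x ξ => ?_,
    fun h hh => N.hom_ext fun x => (Eq.trans ?_ (hdesc x).symm)⟩
  · refine (Category.assoc _ _ _).trans ?_
    refine (congrArg (copower.ι _ x ξ ≫ ·) (hdesc x)).trans ?_
    exact copower.ι_desc _ _
  · refine copower.hom_ext fun ξ => ?_
    refine Eq.trans ?_ (copower.ι_desc _ _).symm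
    exact (Category.assoc _ _ _).symm.trans (hh x ξ)

theorem family_map {y y' : X} (g : y ⟶ y') (x : X) (ξ : Module.Dual k (y ⟶ x)) :
    (N.family y).app x ξ ≫ N.functor.map g = (N.family y').app x (ξ ∘ₗ Linear.leftComp k x g) := by
  have h := copower.ι _ x ξ ≫= N.ι_map g x
  rw [← Category.assoc, ← Category.assoc, copower.ι_map, Category.id_comp] at h
  exact h

end RightNakayama

theorem nonempty_rightNakayama (X : FinLinCat.{u, v, w} k) : Nonempty (RightNakayama X) := by
  choose E ρ hρ using fun y : X => RightFamily.exists_isUniversal y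
  let θ (y : X) (s : Cowedge (dualHomCopower y)) : RightFamily (𝟭 X) y s.pt :=
    RightFamily.ofDinatural s.π fun f => Cowedge.condition s f
  refine ⟨⟨fun y => Cowedge.mk (E y) (fun x => copower.desc ((ρ y).app x))
      fun x x' f => (ρ y).desc_dinatural f,
    fun y => Multicofork.IsColimit.mk _ (fun s => (hρ y s.pt (θ y s)).choose)
      (fun s (x : X) => ?_) (fun s m hm => ?_)⟩⟩
  · refine copower.hom_ext (k := k) (V := Module.Dual k (y ⟶ x)) fun ξ => ?_
    refine (Category.assoc _ _ _).symm.trans ?_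
    refine (congrArg (· ≫ (hρ y s.pt (θ y s)).choose)
      (copower.ι_desc ((ρ y).app x) ξ)).trans ?_
    exact (hρ y s.pt (θ y s)).choose_spec.1 x ξ
  · refine (hρ y s.pt (θ y s)).choose_spec.2 m fun x ξ => ?_
    refine (congrArg (· ≫ m) (copower.ι_desc ((ρ y).app x) ξ).symm).trans
      ((Category.assoc _ _ _).trans ?_)
    exact congrArg (copower.ι (Module.Dual k (y ⟶ x)) x ξ ≫ ·) (hm x)

end NakayamaFamilies

/-! ### Linear adjunctions -/

section LinearAdjunction

variable {k : Type u} [Field k] {A B : FinLinCat.{u, v, w} k} {L : A ⥤ B} {R : B ⥤ A}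

theorem left_adjoint_linear (adj : L ⊣ R) [R.Linear k] : L.Linear k where
  map_smul f r := (adj.homEquiv _ _).injective (by
    simp [Adjunction.homEquiv_unit, R.map_smul])

theorem right_adjoint_linear (adj : L ⊣ R) [L.Linear k] : R.Linear k where
  map_smul f r := (adj.homEquiv _ _).symm.injective (by
    simp [Adjunction.homEquiv_counit, L.map_smul])

/-- The bijection `Hom(L x, y) ≃ Hom(x, R y)` of an adjunction with linear right adjoint. -/
def homLinearEquiv (k : Type u) [Field k] {A B : FinLinCat.{u, v, w} k} {L : A ⥤ B} {R : B ⥤ A}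
    (adj : L ⊣ R) [R.Additive] [R.Linear k] (x : A) (y : B) :
    (L.obj x ⟶ y) ≃ₗ[k] (x ⟶ R.obj y) where
  toEquiv := adj.homEquiv x y
  map_add' f g := by simp [Adjunction.homEquiv_unit]
  map_smul' r f := by simp [Adjunction.homEquiv_unit, R.map_smul]

theorem homLinearEquiv_apply (adj : L ⊣ R) [R.Additive] [R.Linear k] (x : A) (y : B)
    (f : L.obj x ⟶ y) : homLinearEquiv k adj x y f = adj.unit.app x ≫ R.map f :=
  adj.homEquiv_unit ..

theorem homLinearEquiv_symm_apply (adj : L ⊣ R) [R.Additive] [R.Linear k] (x : A) (y : B)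
    (f : x ⟶ R.obj y) :
    (homLinearEquiv k adj x y).symm f = L.map f ≫ adj.counit.app y :=
  adj.homEquiv_counit ..

/-- Compatibility of the isomorphism between left adjoints induced by an isomorphism of right
adjoints with the counits. -/
theorem leftAdjointUniq_ofNatIsoRight_inv_counit {C D : Type*} [Category* C] [Category* D]
    {L L' : C ⥤ D} {R R' : D ⥤ C} (adj : L ⊣ R) (adj' : L' ⊣ R') (γ : R ≅ R') (y : D) :
    ((adj.ofNatIsoRight γ).leftAdjointUniq adj').inv.app (R.obj y) ≫ adj.counit.app y =
      L'.map (γ.hom.app y) ≫ adj'.counit.app y := by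
  have h := (adj.ofNatIsoRight γ).leftAdjointUniq_hom_app_counit adj' y
  have h' : (adj.ofNatIsoRight γ).counit.app y = L.map (γ.inv.app y) ≫ adj.counit.app y := by
    rw [← Adjunction.homEquiv_symm_id, Adjunction.homEquiv_ofNatIsoRight_symm_apply,
      Adjunction.homEquiv_counit, Category.id_comp]
  rw [← cancel_epi (((adj.ofNatIsoRight γ).leftAdjointUniq adj').hom.app (R.obj y)),
    Iso.hom_inv_id_app_assoc, ← NatTrans.naturality_assoc, h, h', ← L.map_comp_assoc]
  simp

/-- Compatibility of the isomorphism between right adjoints induced by an isomorphism of left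
adjoints with the units. -/
theorem unit_rightAdjointUniq_ofNatIsoLeft {C D : Type*} [Category* C] [Category* D]
    {L L' : C ⥤ D} {R R' : D ⥤ C} (adj : L ⊣ R) (adj' : L' ⊣ R') (γ : L ≅ L') (x : C) :
    adj.unit.app x ≫ ((adj.ofNatIsoLeft γ).rightAdjointUniq adj').hom.app (L.obj x) ≫
      R'.map (γ.hom.app x) = adj'.unit.app x := by
  have h := (adj.ofNatIsoLeft γ).unit_rightAdjointUniq_hom_app adj' x
  have h' : (adj.ofNatIsoLeft γ).unit.app x = adj.unit.app x ≫ R.map (γ.hom.app x) := by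
    rw [← Adjunction.homEquiv_id, Adjunction.homEquiv_ofNatIsoLeft_apply,
      Adjunction.homEquiv_unit, Category.comp_id]
  rw [← h, h', Category.assoc, NatTrans.naturality]

end LinearAdjunction

/-! ### The comparison for the left exact Nakayama functors -/

section LeftComparison

variable {k : Type u} [Field k]

namespace DoubleLeftAdjoint

variable {A B : FinLinCat.{u, v, w} k} {F : A ⥤ B} [F.Additive] [F.Linear k]
  (D : DoubleLeftAdjoint F) (NA : LeftNakayama A) (NB : LeftNakayama B)

/-- The family `Hom(b, F y)^* ≅ Hom(F^la b, y)^* → Hom(F^lla (N y), F^lla (F^la b)) →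
Hom(F^lla (N y), b)`. -/
def toFamily (y : A) : LeftFamily (𝟭 B) (F.obj y) (D.lla.obj (NA.functor.obj y)) :=
  haveI := D.adj.left_adjoint_additive
  haveI := left_adjoint_linear (k := k) D.adj
  haveI := D.adj'.left_adjoint_additive
  haveI := left_adjoint_linear (k := k) D.adj'
  { app := fun b => Linear.rightComp k _ (D.adj'.counit.app b) ∘ₗ D.lla.mapLinearMap k ∘ₗ
      (NA.family y).app (D.la.obj b) ∘ₗ
      (homLinearEquiv k D.adj b y).toLinearMap.dualMap
    naturality := fun {b b'} f ξ => by
      have h := D.adj'.counit.naturality f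
      have h2 := congrArg D.lla.map ((NA.family y).naturality (D.la.map f)
        (ξ ∘ₗ (homLinearEquiv k D.adj b y).toLinearMap))
      simp only [Functor.id_map, Functor.comp_map, Functor.map_comp] at h h2
      change (D.lla.map ((NA.family y).app (D.la.obj b) (ξ ∘ₗ _)) ≫ _) ≫ f =
        D.lla.map ((NA.family y).app (D.la.obj b') _) ≫ _
      rw [Category.assoc, ← h, ← Category.assoc]
      refine (congrArg (· ≫ D.adj'.counit.app b') h2).trans ?_
      congr 4
      ext a
      simp [homLinearEquiv_apply] }

/-- The morphism `F^lla (N y) ⟶ N (F y)`. -/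
def invApp (y : A) : D.lla.obj (NA.functor.obj y) ⟶ NB.functor.obj (F.obj y) :=
  (NB.family_isUniversal _ _ (D.toFamily NA y)).choose

theorem invApp_family (y : A) (b : B) (ξ : Module.Dual k (b ⟶ F.obj y)) :
    D.invApp NA NB y ≫ (NB.family (F.obj y)).app b ξ =
      D.lla.map ((NA.family y).app (D.la.obj b)
        (ξ ∘ₗ (homLinearEquiv k D.adj b y).toLinearMap)) ≫ D.adj'.counit.app b :=
  (NB.family_isUniversal _ _ (D.toFamily NA y)).choose_spec.1 b ξ

/-- The family `Hom(a, y)^* → Hom(F^la (F^lla a), y)^* ≅ Hom(F^lla a, F y)^* →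
Hom(N (F y), F^lla a)`. -/
def fromFamily (y : A) : LeftFamily D.lla y (NB.functor.obj (F.obj y)) where
  app a := (NB.family (F.obj y)).app (D.lla.obj a) ∘ₗ
    (Linear.leftComp k y (D.adj'.unit.app a) ∘ₗ
      (homLinearEquiv k D.adj (D.lla.obj a) y).symm.toLinearMap).dualMap
  naturality {a a'} f ξ := by
    refine ((NB.family (F.obj y)).naturality (D.lla.map f) _).trans ?_
    refine congrArg ((NB.family (F.obj y)).app (D.lla.obj a')) ?_
    have h := D.adj'.unit.naturality f
    simp only [Functor.id_map, Functor.comp_map] at h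
    ext c
    simp only [LinearMap.comp_apply, LinearMap.dualMap_apply, Linear.leftComp_apply,
      LinearEquiv.coe_coe, homLinearEquiv_symm_apply, Functor.map_comp, Category.assoc]
    rw [← reassoc_of% h]

theorem family_map_isUniversal (y : A) :
    haveI := D.adj.left_adjoint_additive
    haveI := left_adjoint_linear (k := k) D.adj
    haveI := D.adj'.left_adjoint_additive
    haveI := left_adjoint_linear (k := k) D.adj'
    ((NA.family y).map D.lla).IsUniversal := by
  have := D.adj.left_adjoint_additive
  have := left_adjoint_linear (k := k) D.adj
  have := D.adj'.left_adjoint_additive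
  have := left_adjoint_linear (k := k) D.adj'
  have := D.lla_leftExact
  exact (NA.family_isUniversal y).map D.lla

theorem lla_hom_ext {y : A} {z : B} {f g : z ⟶ D.lla.obj (NA.functor.obj y)}
    (h : ∀ (a : A) (ξ : Module.Dual k (a ⟶ y)),
      f ≫ D.lla.map ((NA.family y).app a ξ) = g ≫ D.lla.map ((NA.family y).app a ξ)) : f = g :=
  (D.family_map_isUniversal NA y).hom_ext h

/-- The morphism `N (F y) ⟶ F^lla (N y)`. -/
def homApp (y : A) : NB.functor.obj (F.obj y) ⟶ D.lla.obj (NA.functor.obj y) :=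
  (D.family_map_isUniversal NA y _ (D.fromFamily NB y)).choose

theorem homApp_map_family (y a : A) (ξ : Module.Dual k (a ⟶ y)) :
    D.homApp NA NB y ≫ D.lla.map ((NA.family y).app a ξ) =
      (NB.family (F.obj y)).app (D.lla.obj a)
        (ξ ∘ₗ Linear.leftComp k y (D.adj'.unit.app a) ∘ₗ
          (homLinearEquiv k D.adj (D.lla.obj a) y).symm.toLinearMap) :=
  (D.family_map_isUniversal NA y _ (D.fromFamily NB y)).choose_spec.1 a ξ

theorem invApp_homApp (y : A) : D.invApp NA NB y ≫ D.homApp NA NB y = 𝟙 _ := by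
  refine D.lla_hom_ext NA fun a ξ => ?_
  rw [Category.assoc, homApp_map_family, invApp_family]
  have h : (ξ ∘ₗ Linear.leftComp k y (D.adj'.unit.app a) ∘ₗ
      (homLinearEquiv k D.adj (D.lla.obj a) y).symm.toLinearMap) ∘ₗ
      (homLinearEquiv k D.adj (D.lla.obj a) y).toLinearMap =
      ξ ∘ₗ Linear.leftComp k y (D.adj'.unit.app a) := by
    ext c
    simp
  have h2 : (NA.family y).app a ξ ≫ D.adj'.unit.app a =
      (NA.family y).app (D.la.obj (D.lla.obj a)) (ξ ∘ₗ Linear.leftComp k y (D.adj'.unit.app a)) :=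
    (NA.family y).naturality (D.adj'.unit.app a) ξ
  rw [h, ← h2, Category.id_comp]
  refine (congrArg (· ≫ _) (D.lla.map_comp _ _)).trans ?_
  refine (Category.assoc _ _ _).trans ?_
  exact (congrArg (_ ≫ ·) (D.adj'.left_triangle_components a)).trans (Category.comp_id _)

theorem homApp_invApp (y : A) : D.homApp NA NB y ≫ D.invApp NA NB y = 𝟙 _ := by
  refine (NB.family_isUniversal _).hom_ext fun b ξ => ?_
  rw [Category.assoc, invApp_family, Category.id_comp, ← Category.assoc, homApp_map_family]
  refine ((NB.family (F.obj y)).naturality (D.adj'.counit.app b) _).trans ?_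
  refine congrArg ((NB.family (F.obj y)).app b) ?_
  ext c
  simp only [LinearMap.comp_apply, Linear.leftComp_apply, LinearEquiv.coe_coe]
  congr 1
  rw [← LinearEquiv.eq_symm_apply]
  simp [homLinearEquiv_symm_apply]

/-- The isomorphism `N ∘ F ≅ F^lla ∘ N`. -/
def nakayamaIso : F ⋙ NB.functor ≅ NA.functor ⋙ D.lla :=
  Iso.symm <| NatIso.ofComponents
    (fun y => ⟨D.invApp NA NB y, D.homApp NA NB y, D.invApp_homApp NA NB y,
      D.homApp_invApp NA NB y⟩)
    (fun {y y'} g => by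
      refine (NB.family_isUniversal _).hom_ext fun b ξ => ?_
      have h1 := NB.map_family (F.map g) b ξ
      have h2 := NA.map_family g (D.la.obj b) (ξ ∘ₗ (homLinearEquiv k D.adj b y').toLinearMap)
      change (D.lla.map (NA.functor.map g) ≫ D.invApp NA NB y') ≫ _ =
        (D.invApp NA NB y ≫ NB.functor.map (F.map g)) ≫ _
      rw [Category.assoc, Category.assoc, h1, invApp_family, invApp_family, ← Category.assoc]
      refine (congrArg (· ≫ _) (D.lla.map_comp _ _).symm).trans ?_
      rw [h2]
      refine congrArg (fun t => D.lla.map ((NA.family y).app (D.la.obj b) t) ≫ _) ?_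
      ext c
      simp [homLinearEquiv_apply])

end DoubleLeftAdjoint

variable {A B C : FinLinCat.{u, v, w} k} {F₁ : A ⥤ B} {F₂ : B ⥤ C} [F₁.Additive] [F₁.Linear k]
  [F₂.Additive] [F₂.Linear k] (D₁₂ : DoubleLeftAdjoint (F₁ ⋙ F₂)) (D₁ : DoubleLeftAdjoint F₁)
  (D₂ : DoubleLeftAdjoint F₂) (NA : LeftNakayama A) (NB : LeftNakayama B) (NC : LeftNakayama C)

/-- Coherence of the inverse comparison morphisms `F^lla (N y) ⟶ N (F y)`. -/
theorem DoubleLeftAdjoint.invApp_comp (x : A) :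
    D₂.lla.map (D₁.invApp NA NB x) ≫ D₂.invApp NB NC (F₁.obj x) =
      (D₁₂.compIso D₁ D₂).inv.app (NA.functor.obj x) ≫ D₁₂.invApp NA NC x := by
  refine (NC.family_isUniversal _).hom_ext fun c ξ => ?_
  let γ := D₁₂.adj.leftAdjointUniq (D₂.adj.comp D₁.adj)
  have e1 := D₁₂.invApp_family NA NC x c ξ
  have e2 := D₂.invApp_family NB NC (F₁.obj x) c ξ
  have e3 := D₁.invApp_family NA NB x (D₂.la.obj c)
    (ξ ∘ₗ (homLinearEquiv k D₂.adj c (F₁.obj x)).toLinearMap)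
  have hγ := leftAdjointUniq_ofNatIsoRight_inv_counit D₁₂.adj' (D₁.adj'.comp D₂.adj') γ c
  have hunit : D₁₂.adj.unit.app c ≫ F₂.map (F₁.map (γ.hom.app c)) =
      D₂.adj.unit.app c ≫ F₂.map (D₁.adj.unit.app (D₂.la.obj c)) :=
    (D₁₂.adj.unit_leftAdjointUniq_hom_app (D₂.adj.comp D₁.adj) c).trans (by simp)
  have hfam : (NA.family x).app (D₁₂.la.obj c) (ξ ∘ₗ (homLinearEquiv k D₁₂.adj c x).toLinearMap) ≫
      γ.hom.app c = (NA.family x).app (D₁.la.obj (D₂.la.obj c))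
        ((ξ ∘ₗ (homLinearEquiv k D₁₂.adj c x).toLinearMap) ∘ₗ Linear.leftComp k x (γ.hom.app c)) :=
    (NA.family x).naturality (γ.hom.app c) _
  have hlin : (ξ ∘ₗ (homLinearEquiv k D₁₂.adj c x).toLinearMap) ∘ₗ
      Linear.leftComp k x (γ.hom.app c) =
      (ξ ∘ₗ (homLinearEquiv k D₂.adj c (F₁.obj x)).toLinearMap) ∘ₗ
        (homLinearEquiv k D₁.adj (D₂.la.obj c) x).toLinearMap := by
    ext a
    simp only [LinearMap.comp_apply, Linear.leftComp_apply, LinearEquiv.coe_coe,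
      homLinearEquiv_apply]
    congr 1
    rw [Functor.comp_map, Functor.map_comp, Functor.map_comp, reassoc_of% hunit]
    simp
  rw [hlin] at hfam
  let T := (NA.family x).app (D₁₂.la.obj c) (ξ ∘ₗ (homLinearEquiv k D₁₂.adj c x).toLinearMap)
  calc (D₂.lla.map (D₁.invApp NA NB x) ≫ D₂.invApp NB NC (F₁.obj x)) ≫
        (NC.family (F₂.obj (F₁.obj x))).app c ξ
      = D₂.lla.map (D₁.lla.map (T ≫ γ.hom.app c) ≫ D₁.adj'.counit.app (D₂.la.obj c)) ≫
          D₂.adj'.counit.app c := by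
        rw [hfam, ← e3, D₂.lla.map_comp, Category.assoc, Category.assoc, e2]
    _ = (D₁.lla ⋙ D₂.lla).map T ≫ (D₁.lla ⋙ D₂.lla).map (γ.hom.app c) ≫
          (D₁.adj'.comp D₂.adj').counit.app c := by
        simp
    _ = (D₁₂.compIso D₁ D₂).inv.app (NA.functor.obj x) ≫ D₁₂.lla.map T ≫
          D₁₂.adj'.counit.app c := by
        rw [← hγ]
        exact ((D₁₂.compIso D₁ D₂).inv.naturality_assoc T _)
    _ = _ := by
        rw [Category.assoc]
        exact congrArg (_ ≫ ·) e1.symm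

theorem DoubleLeftAdjoint.nakayamaIso_comp (x : A) :
    (D₂.nakayamaIso NB NC).hom.app (F₁.obj x) ≫ D₂.lla.map ((D₁.nakayamaIso NA NB).hom.app x) =
      (D₁₂.nakayamaIso NA NC).hom.app x ≫ (D₁₂.compIso D₁ D₂).hom.app (NA.functor.obj x) := by
  have h := DoubleLeftAdjoint.invApp_comp D₁₂ D₁ D₂ NA NB NC x
  let i₁ := (D₁.nakayamaIso NA NB).app x
  let i₂ := (D₂.nakayamaIso NB NC).app (F₁.obj x)
  let i₁₂ := (D₁₂.nakayamaIso NA NC).app x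
  let c := (D₁₂.compIso D₁ D₂).app (NA.functor.obj x)
  have h' : i₂ ≪≫ D₂.lla.mapIso i₁ = i₁₂ ≪≫ c := (Iso.symm_eq_iff).1 (Iso.ext h)
  exact congrArg Iso.hom h'

end LeftComparison

/-! ### The comparison for the right exact Nakayama functors -/

section RightComparison

variable {k : Type u} [Field k]

namespace DoubleRightAdjoint

variable {A B : FinLinCat.{u, v, w} k} {G : A ⥤ B} [G.Additive] [G.Linear k]
  (D : DoubleRightAdjoint G) (NA : RightNakayama A) (NB : RightNakayama B)

instance ra_additive : D.ra.Additive := D.adj.right_adjoint_additive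

instance ra_linear : D.ra.Linear k := right_adjoint_linear D.adj

instance rra_additive : D.rra.Additive := D.adj'.right_adjoint_additive

instance rra_linear : D.rra.Linear k := right_adjoint_linear D.adj'

/-- The family `Hom(G y, b)^* ≅ Hom(y, G^ra b)^* → Hom(G^rra (G^ra b), G^rra (N y)) →
Hom(b, G^rra (N y))`. -/
def toFamily (y : A) : RightFamily (𝟭 B) (G.obj y) (D.rra.obj (NA.functor.obj y)) where
  app b := Linear.leftComp k _ (D.adj'.unit.app b) ∘ₗ D.rra.mapLinearMap k ∘ₗ
    (NA.family y).app (D.ra.obj b) ∘ₗ (homLinearEquiv k D.adj y b).symm.toLinearMap.dualMap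
  naturality {b b'} f ξ := by
    have h := D.adj'.unit.naturality f
    have h2 := congrArg D.rra.map ((NA.family y).naturality (D.ra.map f)
      (ξ ∘ₗ (homLinearEquiv k D.adj y b').symm.toLinearMap))
    simp only [Functor.id_map, Functor.comp_map, Functor.map_comp] at h h2
    change f ≫ D.adj'.unit.app b' ≫ D.rra.map ((NA.family y).app (D.ra.obj b') (ξ ∘ₗ _)) =
      _ ≫ D.rra.map ((NA.family y).app (D.ra.obj b) _)
    rw [reassoc_of% h]
    refine (congrArg (D.adj'.unit.app b ≫ ·) h2).trans ?_
    refine congrArg (fun t => _ ≫ D.rra.map ((NA.family y).app (D.ra.obj b) t)) ?_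
    ext a
    simp [homLinearEquiv_symm_apply]

/-- The morphism `N (G y) ⟶ G^rra (N y)`. -/
def homApp (y : A) : NB.functor.obj (G.obj y) ⟶ D.rra.obj (NA.functor.obj y) :=
  (NB.family_isUniversal _ _ (D.toFamily NA y)).choose

theorem family_homApp (y : A) (b : B) (ξ : Module.Dual k (G.obj y ⟶ b)) :
    (NB.family (G.obj y)).app b ξ ≫ D.homApp NA NB y =
      D.adj'.unit.app b ≫ D.rra.map ((NA.family y).app (D.ra.obj b)
        (ξ ∘ₗ (homLinearEquiv k D.adj y b).symm.toLinearMap)) :=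
  (NB.family_isUniversal _ _ (D.toFamily NA y)).choose_spec.1 b ξ

/-- The family `Hom(y, a)^* → Hom(y, G^ra (G^rra a))^* ≅ Hom(G y, G^rra a)^* →
Hom(G^rra a, N (G y))`. -/
def fromFamily (y : A) : RightFamily D.rra y (NB.functor.obj (G.obj y)) where
  app a := (NB.family (G.obj y)).app (D.rra.obj a) ∘ₗ
    (Linear.rightComp k y (D.adj'.counit.app a) ∘ₗ
      (homLinearEquiv k D.adj y (D.rra.obj a)).toLinearMap).dualMap
  naturality {a a'} f ξ := by
    refine ((NB.family (G.obj y)).naturality (D.rra.map f) _).trans ?_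
    refine congrArg ((NB.family (G.obj y)).app (D.rra.obj a)) ?_
    have h := D.adj'.counit.naturality f
    simp only [Functor.id_map, Functor.comp_map] at h
    ext c
    simp only [LinearMap.comp_apply, LinearMap.dualMap_apply, Linear.rightComp_apply,
      LinearEquiv.coe_coe, homLinearEquiv_apply, Functor.map_comp, Category.assoc]
    rw [h]

theorem map_family_isUniversal (y : A) : ((NA.family y).map D.rra).IsUniversal :=
  haveI := D.rra_rightExact
  (NA.family_isUniversal y).map D.rra

theorem rra_hom_ext {y : A} {z : B} {f g : D.rra.obj (NA.functor.obj y) ⟶ z}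
    (h : ∀ (a : A) (ξ : Module.Dual k (y ⟶ a)),
      D.rra.map ((NA.family y).app a ξ) ≫ f = D.rra.map ((NA.family y).app a ξ) ≫ g) : f = g :=
  (D.map_family_isUniversal NA y).hom_ext h

/-- The morphism `G^rra (N y) ⟶ N (G y)`. -/
def invApp (y : A) : D.rra.obj (NA.functor.obj y) ⟶ NB.functor.obj (G.obj y) :=
  (D.map_family_isUniversal NA y _ (D.fromFamily NB y)).choose

theorem map_family_invApp (y a : A) (ξ : Module.Dual k (y ⟶ a)) :
    D.rra.map ((NA.family y).app a ξ) ≫ D.invApp NA NB y =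
      (NB.family (G.obj y)).app (D.rra.obj a)
        (ξ ∘ₗ Linear.rightComp k y (D.adj'.counit.app a) ∘ₗ
          (homLinearEquiv k D.adj y (D.rra.obj a)).toLinearMap) :=
  (D.map_family_isUniversal NA y _ (D.fromFamily NB y)).choose_spec.1 a ξ

theorem invApp_homApp (y : A) : D.invApp NA NB y ≫ D.homApp NA NB y = 𝟙 _ := by
  refine D.rra_hom_ext NA fun a ξ => ?_
  rw [← Category.assoc, map_family_invApp, family_homApp]
  have h : (ξ ∘ₗ Linear.rightComp k y (D.adj'.counit.app a) ∘ₗ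
      (homLinearEquiv k D.adj y (D.rra.obj a)).toLinearMap) ∘ₗ
      (homLinearEquiv k D.adj y (D.rra.obj a)).symm.toLinearMap =
      ξ ∘ₗ Linear.rightComp k y (D.adj'.counit.app a) := by
    ext c
    simp
  have h2 : D.adj'.counit.app a ≫ (NA.family y).app a ξ =
      (NA.family y).app (D.ra.obj (D.rra.obj a))
        (ξ ∘ₗ Linear.rightComp k y (D.adj'.counit.app a)) :=
    (NA.family y).naturality (D.adj'.counit.app a) ξ
  rw [h, ← h2, Category.comp_id]
  refine (congrArg (_ ≫ ·) (D.rra.map_comp _ _)).trans ?_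
  refine (Category.assoc _ _ _).symm.trans ?_
  exact (congrArg (· ≫ _) (D.adj'.right_triangle_components a)).trans (Category.id_comp _)

theorem homApp_invApp (y : A) : D.homApp NA NB y ≫ D.invApp NA NB y = 𝟙 _ := by
  refine (NB.family_isUniversal _).hom_ext fun b ξ => ?_
  rw [← Category.assoc, family_homApp, Category.comp_id, Category.assoc, map_family_invApp]
  refine ((NB.family (G.obj y)).naturality (D.adj'.unit.app b) _).trans ?_
  refine congrArg ((NB.family (G.obj y)).app b) ?_
  ext c
  simp only [LinearMap.comp_apply, Linear.rightComp_apply, LinearEquiv.coe_coe]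
  congr 1
  rw [LinearEquiv.symm_apply_eq]
  simp [homLinearEquiv_apply]

/-- The isomorphism `N ∘ G ≅ G^rra ∘ N`. -/
def nakayamaIso : G ⋙ NB.functor ≅ NA.functor ⋙ D.rra :=
  NatIso.ofComponents
    (fun y => ⟨D.homApp NA NB y, D.invApp NA NB y, D.homApp_invApp NA NB y,
      D.invApp_homApp NA NB y⟩)
    (fun {y y'} g => by
      refine (NB.family_isUniversal _).hom_ext fun b ξ => ?_
      have h1 := NB.family_map (G.map g) b ξ
      have h2 := NA.family_map g (D.ra.obj b)
        (ξ ∘ₗ (homLinearEquiv k D.adj y b).symm.toLinearMap)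
      change _ ≫ NB.functor.map (G.map g) ≫ D.homApp NA NB y' =
        _ ≫ D.homApp NA NB y ≫ D.rra.map (NA.functor.map g)
      rw [← Category.assoc, ← Category.assoc, h1, family_homApp, family_homApp, Category.assoc]
      refine Eq.trans ?_ (congrArg (_ ≫ ·) (D.rra.map_comp _ _))
      rw [h2]
      refine congrArg (fun t => _ ≫ D.rra.map ((NA.family y').app (D.ra.obj b) t)) ?_
      ext c
      simp [homLinearEquiv_symm_apply])

end DoubleRightAdjoint

variable {A B C : FinLinCat.{u, v, w} k} {G₁ : A ⥤ B} {G₂ : B ⥤ C} [G₁.Additive] [G₁.Linear k]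
  [G₂.Additive] [G₂.Linear k] (D₁₂ : DoubleRightAdjoint (G₁ ⋙ G₂)) (D₁ : DoubleRightAdjoint G₁)
  (D₂ : DoubleRightAdjoint G₂) (NA : RightNakayama A) (NB : RightNakayama B)
  (NC : RightNakayama C)

theorem DoubleRightAdjoint.nakayamaIso_comp (x : A) :
    (D₂.nakayamaIso NB NC).hom.app (G₁.obj x) ≫ D₂.rra.map ((D₁.nakayamaIso NA NB).hom.app x) =
      (D₁₂.nakayamaIso NA NC).hom.app x ≫ (D₁₂.compIso D₁ D₂).hom.app (NA.functor.obj x) := by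
  change D₂.homApp NB NC (G₁.obj x) ≫ D₂.rra.map (D₁.homApp NA NB x) =
    D₁₂.homApp NA NC x ≫ (D₁₂.compIso D₁ D₂).hom.app (NA.functor.obj x)
  refine (NC.family_isUniversal _).hom_ext fun c ξ => ?_
  let γ := D₁₂.adj.rightAdjointUniq (D₁.adj.comp D₂.adj)
  have e1 := D₁₂.family_homApp NA NC x c ξ
  have e2 := D₂.family_homApp NB NC (G₁.obj x) c ξ
  have e3 := D₁.family_homApp NA NB x (D₂.ra.obj c)
    (ξ ∘ₗ (homLinearEquiv k D₂.adj (G₁.obj x) c).symm.toLinearMap)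
  have hγ := unit_rightAdjointUniq_ofNatIsoLeft D₁₂.adj' (D₂.adj'.comp D₁.adj') γ c
  have hcounit : G₂.map (G₁.map (γ.hom.app c)) ≫ G₂.map (D₁.adj.counit.app (D₂.ra.obj c)) ≫
      D₂.adj.counit.app c = D₁₂.adj.counit.app c :=
    Eq.trans (by simp [γ]) (D₁₂.adj.rightAdjointUniq_hom_app_counit (D₁.adj.comp D₂.adj) c)
  have hfam : γ.hom.app c ≫ (NA.family x).app (D₁.ra.obj (D₂.ra.obj c))
        ((ξ ∘ₗ (homLinearEquiv k D₂.adj (G₁.obj x) c).symm.toLinearMap) ∘ₗ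
          (homLinearEquiv k D₁.adj x (D₂.ra.obj c)).symm.toLinearMap) =
      (NA.family x).app (D₁₂.ra.obj c)
        (((ξ ∘ₗ (homLinearEquiv k D₂.adj (G₁.obj x) c).symm.toLinearMap) ∘ₗ
          (homLinearEquiv k D₁.adj x (D₂.ra.obj c)).symm.toLinearMap) ∘ₗ
            Linear.rightComp k x (γ.hom.app c)) :=
    (NA.family x).naturality (γ.hom.app c) _
  have hlin : ((ξ ∘ₗ (homLinearEquiv k D₂.adj (G₁.obj x) c).symm.toLinearMap) ∘ₗ
      (homLinearEquiv k D₁.adj x (D₂.ra.obj c)).symm.toLinearMap) ∘ₗ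
        Linear.rightComp k x (γ.hom.app c) =
      ξ ∘ₗ (homLinearEquiv k D₁₂.adj x c).symm.toLinearMap := by
    ext a
    simp only [LinearMap.comp_apply, Linear.rightComp_apply, LinearEquiv.coe_coe,
      homLinearEquiv_symm_apply]
    congr 1
    rw [Functor.comp_map, ← hcounit]
    simp
  rw [hlin] at hfam
  let T := (NA.family x).app (D₁.ra.obj (D₂.ra.obj c))
    ((ξ ∘ₗ (homLinearEquiv k D₂.adj (G₁.obj x) c).symm.toLinearMap) ∘ₗ
      (homLinearEquiv k D₁.adj x (D₂.ra.obj c)).symm.toLinearMap)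
  calc (NC.family (G₂.obj (G₁.obj x))).app c ξ ≫ D₂.homApp NB NC (G₁.obj x) ≫
        D₂.rra.map (D₁.homApp NA NB x)
      = D₂.adj'.unit.app c ≫ D₂.rra.map (D₁.adj'.unit.app (D₂.ra.obj c) ≫ D₁.rra.map T) := by
        rw [← e3, D₂.rra.map_comp, ← Category.assoc, e2, Category.assoc]
    _ = (D₂.adj'.comp D₁.adj').unit.app c ≫ (D₁.rra ⋙ D₂.rra).map T := by
        simp
    _ = D₁₂.adj'.unit.app c ≫ (D₁₂.compIso D₁ D₂).hom.app (D₁₂.ra.obj c) ≫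
          (D₁.rra ⋙ D₂.rra).map (γ.hom.app c ≫ T) := by
        rw [← hγ, Functor.map_comp, Category.assoc, Category.assoc]
        rfl
    _ = (D₁₂.adj'.unit.app c ≫ D₁₂.rra.map (γ.hom.app c ≫ T)) ≫
          (D₁₂.compIso D₁ D₂).hom.app (NA.functor.obj x) := by
        rw [Category.assoc]
        exact congrArg (_ ≫ ·) ((D₁₂.compIso D₁ D₂).hom.naturality _).symm
    _ = _ := by
        rw [hfam, ← Category.assoc]
        exact congrArg (· ≫ _) e1.symm

end RightComparison

end FinLin

end

theorem theorem3p10 (k : Type u) [Field k] :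
    -- the Nakayama functors exist
    (∀ X : FinLin.FinLinCat.{u, v, w} k,
      Nonempty (FinLin.LeftNakayama X) ∧ Nonempty (FinLin.RightNakayama X)) ∧
    -- the isomorphisms `N^l_B ∘ F ≅ F^lla ∘ N^l_A` and their coherence
    (∃ φ : ∀ (A B : FinLin.FinLinCat.{u, v, w} k)
        (NA : FinLin.LeftNakayama A) (NB : FinLin.LeftNakayama B)
        (F : A ⥤ B) [F.Additive] [F.Linear k] [PreservesFiniteLimits F]
        (D : FinLin.DoubleLeftAdjoint F),
        (F ⋙ NB.functor ≅ NA.functor ⋙ D.lla),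
      ∀ (A B C : FinLin.FinLinCat.{u, v, w} k)
        (NA : FinLin.LeftNakayama A) (NB : FinLin.LeftNakayama B) (NC : FinLin.LeftNakayama C)
        (F₁ : A ⥤ B) [F₁.Additive] [F₁.Linear k] [PreservesFiniteLimits F₁]
        (F₂ : B ⥤ C) [F₂.Additive] [F₂.Linear k] [PreservesFiniteLimits F₂]
        (D₁ : FinLin.DoubleLeftAdjoint F₁) (D₂ : FinLin.DoubleLeftAdjoint F₂)
        (D₁₂ : FinLin.DoubleLeftAdjoint (F₁ ⋙ F₂)) (x : A),
        (φ B C NB NC F₂ D₂).hom.app (F₁.obj x) ≫ D₂.lla.map ((φ A B NA NB F₁ D₁).hom.app x) =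
          haveI : PreservesFiniteLimits (F₁ ⋙ F₂) := comp_preservesFiniteLimits F₁ F₂
          (φ A C NA NC (F₁ ⋙ F₂) D₁₂).hom.app x ≫
            (D₁₂.compIso D₁ D₂).hom.app (NA.functor.obj x)) ∧
    -- the isomorphisms `N^r_B ∘ G ≅ G^rra ∘ N^r_A` and their coherence
    (∃ φ : ∀ (A B : FinLin.FinLinCat.{u, v, w} k)
        (NA : FinLin.RightNakayama A) (NB : FinLin.RightNakayama B)
        (G : A ⥤ B) [G.Additive] [G.Linear k] [PreservesFiniteColimits G]
        (D : FinLin.DoubleRightAdjoint G),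
        (G ⋙ NB.functor ≅ NA.functor ⋙ D.rra),
      ∀ (A B C : FinLin.FinLinCat.{u, v, w} k)
        (NA : FinLin.RightNakayama A) (NB : FinLin.RightNakayama B) (NC : FinLin.RightNakayama C)
        (G₁ : A ⥤ B) [G₁.Additive] [G₁.Linear k] [PreservesFiniteColimits G₁]
        (G₂ : B ⥤ C) [G₂.Additive] [G₂.Linear k] [PreservesFiniteColimits G₂]
        (D₁ : FinLin.DoubleRightAdjoint G₁) (D₂ : FinLin.DoubleRightAdjoint G₂)
        (D₁₂ : FinLin.DoubleRightAdjoint (G₁ ⋙ G₂)) (x : A),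
        (φ B C NB NC G₂ D₂).hom.app (G₁.obj x) ≫ D₂.rra.map ((φ A B NA NB G₁ D₁).hom.app x) =
          haveI : PreservesFiniteColimits (G₁ ⋙ G₂) := comp_preservesFiniteColimits G₁ G₂
          (φ A C NA NC (G₁ ⋙ G₂) D₁₂).hom.app x ≫
            (D₁₂.compIso D₁ D₂).hom.app (NA.functor.obj x)) := by
  refine ⟨fun X => ⟨FinLin.nonempty_leftNakayama X, FinLin.nonempty_rightNakayama X⟩,
    ⟨fun A B NA NB F _ _ _ D => D.nakayamaIso NA NB, ?_⟩,
    ⟨fun A B NA NB G _ _ _ D => D.nakayamaIso NA NB, ?_⟩⟩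
  · intro A B C NA NB NC F₁ _ _ _ F₂ _ _ _ D₁ D₂ D₁₂ x
    exact FinLin.DoubleLeftAdjoint.nakayamaIso_comp D₁₂ D₁ D₂ NA NB NC x
  · intro A B C NA NB NC G₁ _ _ _ G₂ _ _ _ D₁ D₂ D₁₂ x
    exact FinLin.DoubleRightAdjoint.nakayamaIso_comp D₁₂ D₁ D₂ NA NB NC x
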